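/- Let $\theta\in\mathbb R$ be irrational. Let $\mathcal A_\theta^{alg}$ be the algebraic noncommutative torus, that is, the $\mathbb C$-algebra of finite sums $\sum a_{n,m}U_1^nU_2^m$ $(n,m\in\mathbb Z,\ a_{n,m}\in\mathbb C)$ in two invertible generators $U_1,U_2$ with $U_2U_1=e^{2\pi i\theta}U_1U_2$. Let $\mathbb Z_2=\{\pm1\}$ act on it by the automorphism $U_j\mapsto U_j^{-1}$ $(j=1,2)$, and let $B=\mathcal A_\theta^{alg}\rtimes\mathbb Z_2$ be the (algebraic) crossed product. Let $B^\ast=\mathrm{Hom}_{\mathbb C}(B,\mathbb C)$ be the algebraic dual with its $B$-bimodule structure $(a\varphi b)(x)=\varphi(bxa)$. Then the Hochschild cohomology of $B$ with coefficients in $B^\ast$ satisfies $$H^0(B,B^\ast)\cong\mathbb C^5,\qquad H^1(B,B^\ast)=0,\qquad H^2(B,B^\ast)\cong\mathbb C$$ as complex vector spaces. -/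

import Mathlib

/-! ### Hochschild cohomology of an algebra with coefficients in a bimodule -/

section Hochschild

/-- The product of two consecutive entries: `(a₀, …, aₙ) ↦ (a₀, …, aⱼ aⱼ₊₁, …, aₙ)` for `j < n`. -/
def mulAdjacent {A : Type*} [Mul A] {n : ℕ} (j : Fin n) (a : Fin (n + 1) → A) : Fin n → A :=
  Fin.contractNth j.castSucc (· * ·) a

theorem mulAdjacent_apply {A : Type*} [Mul A] {n : ℕ} (j : Fin n) (a : Fin (n + 1) → A)
    (i : Fin n) : mulAdjacent j a i =
      if (i : ℕ) < j then a i.castSucc else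
        if (i : ℕ) = j then a i.castSucc * a i.succ else a i.succ := rfl

theorem exists_mulAdjacent_update (k : Type*) {A : Type*} [CommRing k] [Ring A] [Algebra k A]
    {n : ℕ} (j : Fin n) (a : Fin (n + 1) → A) (i : Fin (n + 1)) :
    ∃ (l : Fin n) (L : A →ₗ[k] A), ∀ x : A, mulAdjacent j (Function.update a i x) =
      Function.update (mulAdjacent j a) l (L x) := by
  rcases lt_trichotomy (i : ℕ) (j : ℕ) with h | h | h
  · refine ⟨⟨i, by omega⟩, LinearMap.id, fun x => ?_⟩
    ext l
    simp only [mulAdjacent_apply, Function.update_apply, Fin.ext_iff,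
      Fin.val_castSucc, Fin.val_succ, LinearMap.id_apply] at *
    grind
  · refine ⟨j, LinearMap.mulRight k (a j.succ), fun x => ?_⟩
    ext l
    simp only [mulAdjacent_apply, Function.update_apply, Fin.ext_iff,
      Fin.val_castSucc, Fin.val_succ, LinearMap.mulRight_apply] at *
    grind
  · by_cases h' : (i : ℕ) = j + 1
    · refine ⟨j, LinearMap.mulLeft k (a j.castSucc), fun x => ?_⟩
      ext l
      simp only [mulAdjacent_apply, Function.update_apply, Fin.ext_iff,
        Fin.val_castSucc, Fin.val_succ, LinearMap.mulLeft_apply] at *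
      grind
    · refine ⟨⟨i - 1, by omega⟩, LinearMap.id, fun x => ?_⟩
      ext l
      simp only [mulAdjacent_apply, Function.update_apply, Fin.ext_iff,
        Fin.val_castSucc, Fin.val_succ, LinearMap.id_apply] at *
      grind

variable (k A M : Type*) [CommRing k] [Ring A] [Algebra k A] [AddCommGroup M] [Module k M]
  [Module A M] [Module Aᵐᵒᵖ M] [IsScalarTower k A M] [IsScalarTower k Aᵐᵒᵖ M]

/-- Hochschild `n`-cochains: `k`-multilinear maps `Aⁿ → M`. -/
abbrev HochschildCochain (n : ℕ) : Type _ := MultilinearMap k (fun _ : Fin n => A) M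

variable {k A M}

/-- The summand `a₀ · f(a₁, …, aₙ)` of the Hochschild differential. -/
def HochschildCochain.first {n : ℕ} (f : HochschildCochain k A M n) :
    HochschildCochain k A M (n + 1) where
  toFun a := a 0 • f (Fin.tail a)
  map_update_add' {d} a i x y := by
    rw [Subsingleton.elim d (instDecidableEqFin _)]
    refine Fin.cases ?_ (fun i => ?_) i
    · simp [add_smul]
    · simp [Fin.tail_update_succ, Function.update_of_ne, smul_add,
        (Fin.succ_ne_zero i).symm]
  map_update_smul' {d} a i c x := by
    rw [Subsingleton.elim d (instDecidableEqFin _)]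
    refine Fin.cases ?_ (fun i => ?_) i
    · simp [smul_assoc]
    · simp [Fin.tail_update_succ, Function.update_of_ne, smul_comm c,
        (Fin.succ_ne_zero i).symm]

/-- The summand `f(a₀, …, aⱼ aⱼ₊₁, …, aₙ)` of the Hochschild differential. -/
def HochschildCochain.inner {n : ℕ} (f : HochschildCochain k A M n) (j : Fin n) :
    HochschildCochain k A M (n + 1) where
  toFun a := f (mulAdjacent j a)
  map_update_add' {d} a i x y := by
    rw [Subsingleton.elim d (instDecidableEqFin _)]
    obtain ⟨l, L, h⟩ := exists_mulAdjacent_update k j a i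
    simp [h]
  map_update_smul' {d} a i c x := by
    rw [Subsingleton.elim d (instDecidableEqFin _)]
    obtain ⟨l, L, h⟩ := exists_mulAdjacent_update k j a i
    simp [h]

/-- The summand `f(a₀, …, aₙ₋₁) · aₙ` of the Hochschild differential. -/
def HochschildCochain.last {n : ℕ} (f : HochschildCochain k A M n) :
    HochschildCochain k A M (n + 1) where
  toFun a := MulOpposite.op (a (Fin.last n)) • f (Fin.init a)
  map_update_add' {d} a i x y := by
    rw [Subsingleton.elim d (instDecidableEqFin _)]
    refine Fin.lastCases ?_ (fun i => ?_) i
    · simp [add_smul]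
    · simp [Fin.init_update_castSucc, Function.update_of_ne, smul_add,
        (Fin.castSucc_ne_last i).symm]
  map_update_smul' {d} a i c x := by
    rw [Subsingleton.elim d (instDecidableEqFin _)]
    refine Fin.lastCases ?_ (fun i => ?_) i
    · simp [smul_assoc]
    · simp [Fin.init_update_castSucc, Function.update_of_ne, smul_comm c,
        (Fin.castSucc_ne_last i).symm]

variable (k A M)

/-- The Hochschild differential
`(d f)(a₀, …, aₙ) = a₀ f(a₁, …, aₙ) + ∑_{j < n} (-1)^(j+1) f(…, aⱼ aⱼ₊₁, …)
  + (-1)^(n+1) f(a₀, …, aₙ₋₁) aₙ`. -/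
def hochschildD (n : ℕ) : HochschildCochain k A M n →ₗ[k] HochschildCochain k A M (n + 1) where
  toFun f := f.first + ∑ j : Fin n, (-1 : k) ^ ((j : ℕ) + 1) • f.inner j
    + (-1 : k) ^ (n + 1) • f.last
  map_add' f g := by
    ext a
    simp [HochschildCochain.first, HochschildCochain.inner, HochschildCochain.last,
      Finset.sum_add_distrib]
    abel
  map_smul' c f := by
    ext a
    simp [HochschildCochain.first, HochschildCochain.inner, HochschildCochain.last,
      Finset.smul_sum, smul_comm c]

/-- Hochschild `n`-cocycles. -/
abbrev hochschildCocycles (n : ℕ) : Submodule k (HochschildCochain k A M n) :=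
  LinearMap.ker (hochschildD k A M n)

/-- Hochschild `n`-coboundaries; there are none but `0` in degree `0`. -/
def hochschildCoboundaries : (n : ℕ) → Submodule k (HochschildCochain k A M n)
  | 0 => ⊥
  | n + 1 => LinearMap.range (hochschildD k A M n)

/-- The Hochschild cohomology `Hⁿ(A, M)` of a `k`-algebra `A` with coefficients in an
`A`-bimodule `M`: cocycles modulo coboundaries. -/
abbrev HochschildCohomology [SMulCommClass A Aᵐᵒᵖ M] (n : ℕ) : Type _ :=
  hochschildCocycles k A M n ⧸
    (hochschildCoboundaries k A M n).submoduleOf (hochschildCocycles k A M n)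

end Hochschild

/-! ### The dual bimodule -/

section Dual

variable (k A : Type*) [CommRing k] [Ring A] [Algebra k A]

/-- The dual bimodule `A* = Hom_k(A, k)` of a `k`-algebra `A`, with `(a φ b)(x) = φ(b x a)`. -/
def DualBimodule : Type _ := Module.Dual k A

noncomputable instance : AddCommGroup (DualBimodule k A) :=
  inferInstanceAs (AddCommGroup (Module.Dual k A))

noncomputable instance : Module k (DualBimodule k A) :=
  inferInstanceAs (Module k (Module.Dual k A))

instance : FunLike (DualBimodule k A) A k :=
  inferInstanceAs (FunLike (Module.Dual k A) A k)

variable {k A}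

/-- The left action `(a φ)(x) = φ(x a)`. -/
noncomputable instance : Module A (DualBimodule k A) where
  smul a φ := LinearMap.comp (show Module.Dual k A from φ) (LinearMap.mulRight k a)
  one_smul φ := LinearMap.ext fun x => congrArg (fun y => φ y) (mul_one x)
  mul_smul a b φ := LinearMap.ext fun x => congrArg (fun y => φ y) (mul_assoc x a b).symm
  smul_zero _ := rfl
  smul_add _ _ _ := rfl
  add_smul a b φ := LinearMap.ext fun x =>
    (congrArg (fun y => φ y) (mul_add x a b)).trans (LinearMap.map_add _ _ _)
  zero_smul φ := LinearMap.ext fun x =>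
    (congrArg (fun y => φ y) (mul_zero x)).trans (LinearMap.map_zero _)

/-- The right action `(φ b)(x) = φ(b x)`. -/
noncomputable instance : Module Aᵐᵒᵖ (DualBimodule k A) where
  smul b φ := LinearMap.comp (show Module.Dual k A from φ) (LinearMap.mulLeft k b.unop)
  one_smul φ := LinearMap.ext fun x => congrArg (fun y => φ y) (one_mul x)
  mul_smul a b φ := LinearMap.ext fun x => congrArg (fun y => φ y) (mul_assoc b.unop a.unop x)
  smul_zero _ := rfl
  smul_add _ _ _ := rfl
  add_smul a b φ := LinearMap.ext fun x =>
    (congrArg (fun y => φ y) (add_mul a.unop b.unop x)).trans (LinearMap.map_add _ _ _)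
  zero_smul φ := LinearMap.ext fun x =>
    (congrArg (fun y => φ y) (zero_mul x)).trans (LinearMap.map_zero _)

theorem DualBimodule.smul_apply (a : A) (φ : DualBimodule k A) (x : A) :
    (a • φ) x = φ (x * a) := rfl

theorem DualBimodule.op_smul_apply (b : A) (φ : DualBimodule k A) (x : A) :
    (MulOpposite.op b • φ) x = φ (b * x) := rfl

instance : IsScalarTower k A (DualBimodule k A) where
  smul_assoc c a φ := LinearMap.ext fun x =>
    (congrArg (fun y => φ y) (mul_smul_comm c x a)).trans (LinearMap.map_smul _ _ _)

instance : IsScalarTower k Aᵐᵒᵖ (DualBimodule k A) where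
  smul_assoc c a φ := LinearMap.ext fun x =>
    (congrArg (fun y => φ y) (smul_mul_assoc c a.unop x)).trans (LinearMap.map_smul _ _ _)

instance : SMulCommClass A Aᵐᵒᵖ (DualBimodule k A) where
  smul_comm a b φ := LinearMap.ext fun x =>
    congrArg (fun y => φ y) (mul_assoc b.unop x a).symm

end Dual

/-! ### The algebraic noncommutative torus and its orbifold -/

section Torus

/-- The deformation parameter `λ = e^{2 π i θ}`. -/
noncomputable def torusParam (θ : ℝ) : ℂ := Complex.exp (2 * Real.pi * Complex.I * θ)

theorem torusParam_ne_zero (θ : ℝ) : torusParam θ ≠ 0 := Complex.exp_ne_zero _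

/-- The algebraic noncommutative torus: finite sums `∑ a_{n,m} U₁ⁿ U₂ᵐ`, with the monomial
`U₁ⁿ U₂ᵐ` at the basis vector of index `(n, m)`. -/
def AlgNCTorus (_θ : ℝ) : Type := ℤ × ℤ →₀ ℂ

namespace AlgNCTorus

variable {θ : ℝ}

noncomputable instance : AddCommGroup (AlgNCTorus θ) := inferInstanceAs (AddCommGroup (ℤ × ℤ →₀ ℂ))

noncomputable instance : Module ℂ (AlgNCTorus θ) := inferInstanceAs (Module ℂ (ℤ × ℤ →₀ ℂ))

/-- `mono p c` is `c U₁ⁿ U₂ᵐ`, where `p = (n, m)`. -/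
noncomputable def mono (p : ℤ × ℤ) (c : ℂ) : AlgNCTorus θ := Finsupp.single p c

theorem induction_mono {P : AlgNCTorus θ → Prop} (f : AlgNCTorus θ) (zero : P 0)
    (add : ∀ f g, P f → P g → P (f + g)) (mono : ∀ p c, P (mono p c)) : P f :=
  Finsupp.induction_linear f zero add mono

/-- The product, determined by `U₂ U₁ = λ U₁ U₂`, that is by
`U₁ⁿ U₂ᵐ · U₁ʳ U₂ˢ = λ^(m r) U₁ⁿ⁺ʳ U₂ᵐ⁺ˢ`. -/
noncomputable def mulFinsupp (θ : ℝ) (f g : ℤ × ℤ →₀ ℂ) : ℤ × ℤ →₀ ℂ :=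
  f.sum fun p x => g.sum fun q y =>
    Finsupp.single (p + q) (torusParam θ ^ (p.2 * q.1) * (x * y))

theorem mulFinsupp_zero_left (f : ℤ × ℤ →₀ ℂ) : mulFinsupp θ 0 f = 0 := by
  simp [mulFinsupp]

theorem mulFinsupp_zero_right (f : ℤ × ℤ →₀ ℂ) : mulFinsupp θ f 0 = 0 := by
  simp [mulFinsupp]

theorem mulFinsupp_add_left (f g h : ℤ × ℤ →₀ ℂ) :
    mulFinsupp θ (f + g) h = mulFinsupp θ f h + mulFinsupp θ g h := by
  refine Finsupp.sum_add_index' (fun p => ?_) (fun p x y => ?_)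
  · simp
  · simp only [add_mul, mul_add, Finsupp.single_add, Finsupp.sum_add]

theorem mulFinsupp_add_right (f g h : ℤ × ℤ →₀ ℂ) :
    mulFinsupp θ f (g + h) = mulFinsupp θ f g + mulFinsupp θ f h := by
  simp only [mulFinsupp]
  rw [← Finsupp.sum_add]
  refine Finsupp.sum_congr fun p _ => Finsupp.sum_add_index' (fun q => ?_) (fun q x y => ?_)
  · simp
  · simp only [mul_add, Finsupp.single_add]

noncomputable instance : Mul (AlgNCTorus θ) := ⟨mulFinsupp θ⟩

noncomputable instance : One (AlgNCTorus θ) := ⟨mono 0 1⟩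

theorem one_def : (1 : AlgNCTorus θ) = mono 0 1 := rfl

theorem mono_zero (p : ℤ × ℤ) : (mono p 0 : AlgNCTorus θ) = 0 := Finsupp.single_zero p

theorem mono_add (p : ℤ × ℤ) (x y : ℂ) : (mono p (x + y) : AlgNCTorus θ) = mono p x + mono p y :=
  Finsupp.single_add p x y

theorem smul_mono (c : ℂ) (p : ℤ × ℤ) (x : ℂ) :
    c • (mono p x : AlgNCTorus θ) = mono p (c * x) := Finsupp.smul_single' c p x

theorem mono_mul_mono (p q : ℤ × ℤ) (x y : ℂ) : (mono p x * mono q y : AlgNCTorus θ) =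
    mono (p + q) (torusParam θ ^ (p.2 * q.1) * (x * y)) := by
  change mulFinsupp θ (Finsupp.single p x) (Finsupp.single q y) = Finsupp.single _ _
  simp [mulFinsupp]

protected theorem zero_mul (f : AlgNCTorus θ) : 0 * f = 0 := mulFinsupp_zero_left f

protected theorem mul_zero (f : AlgNCTorus θ) : f * 0 = 0 := mulFinsupp_zero_right f

protected theorem add_mul (f g h : AlgNCTorus θ) : (f + g) * h = f * h + g * h :=
  mulFinsupp_add_left f g h

protected theorem mul_add (f g h : AlgNCTorus θ) : f * (g + h) = f * g + f * h :=
  mulFinsupp_add_right f g h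

protected theorem mul_assoc (f g h : AlgNCTorus θ) : f * g * h = f * (g * h) := by
  induction f using induction_mono with
  | zero => simp only [AlgNCTorus.zero_mul]
  | add f f' hf hf' => simp only [AlgNCTorus.add_mul, hf, hf']
  | mono p x =>
  induction g using induction_mono with
  | zero => simp only [AlgNCTorus.zero_mul, AlgNCTorus.mul_zero]
  | add g g' hg hg' => simp only [AlgNCTorus.add_mul, AlgNCTorus.mul_add, hg, hg']
  | mono q y =>
  induction h using induction_mono with
  | zero => simp only [AlgNCTorus.mul_zero]
  | add h h' hh hh' => simp only [AlgNCTorus.mul_add, hh, hh']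
  | mono r z =>
  simp only [mono_mul_mono, add_assoc, Prod.fst_add, Prod.snd_add, add_mul, mul_add,
    zpow_add₀ (torusParam_ne_zero θ)]
  congr 1
  ring

protected theorem one_mul (f : AlgNCTorus θ) : 1 * f = f := by
  induction f using induction_mono with
  | zero => exact AlgNCTorus.mul_zero _
  | add f g hf hg => rw [AlgNCTorus.mul_add, hf, hg]
  | mono p x => simp [one_def, mono_mul_mono]

protected theorem mul_one (f : AlgNCTorus θ) : f * 1 = f := by
  induction f using induction_mono with
  | zero => exact AlgNCTorus.zero_mul _
  | add f g hf hg => rw [AlgNCTorus.add_mul, hf, hg]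
  | mono p x => simp [one_def, mono_mul_mono]

noncomputable instance : Ring (AlgNCTorus θ) :=
  { (inferInstance : AddCommGroup (AlgNCTorus θ)) with
    zero_mul := AlgNCTorus.zero_mul
    mul_zero := AlgNCTorus.mul_zero
    left_distrib := AlgNCTorus.mul_add
    right_distrib := AlgNCTorus.add_mul
    mul_assoc := AlgNCTorus.mul_assoc
    one_mul := AlgNCTorus.one_mul
    mul_one := AlgNCTorus.mul_one }

protected theorem smul_mul (c : ℂ) (f g : AlgNCTorus θ) : c • f * g = c • (f * g) := by
  induction f using induction_mono with
  | zero => simp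
  | add f f' hf hf' => simp only [smul_add, add_mul, hf, hf']
  | mono p x =>
  induction g using induction_mono with
  | zero => simp
  | add g g' hg hg' => simp only [smul_add, mul_add, hg, hg']
  | mono q y =>
  simp only [smul_mono, mono_mul_mono]
  congr 1
  ring

protected theorem mul_smul (c : ℂ) (f g : AlgNCTorus θ) : f * c • g = c • (f * g) := by
  induction f using induction_mono with
  | zero => simp
  | add f f' hf hf' => simp only [smul_add, add_mul, hf, hf']
  | mono p x =>
  induction g using induction_mono with
  | zero => simp
  | add g g' hg hg' => simp only [smul_add, mul_add, hg, hg']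
  | mono q y =>
  simp only [smul_mono, mono_mul_mono]
  congr 1
  ring

noncomputable instance : Algebra ℂ (AlgNCTorus θ) :=
  Algebra.ofModule AlgNCTorus.smul_mul AlgNCTorus.mul_smul

/-- The defining relation, with `U₁ = mono (1, 0) 1` and `U₂ = mono (0, 1) 1`. -/
theorem U₂_mul_U₁ : (mono (0, 1) 1 * mono (1, 0) 1 : AlgNCTorus θ) =
    Complex.exp (2 * Real.pi * Complex.I * θ) • (mono (1, 0) 1 * mono (0, 1) 1) := by
  simp [mono_mul_mono, smul_mono, torusParam]

/-- The sign `±1` of an element of `ℤ₂`. -/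
def sign (g : Multiplicative (ZMod 2)) : ℤ := if g = 1 then 1 else -1

theorem sign_mul (g h : Multiplicative (ZMod 2)) : sign (g * h) = sign g * sign h := by
  revert g h; decide

theorem sign_mul_self (g : Multiplicative (ZMod 2)) : sign g * sign g = 1 := by
  revert g; decide

/-- The action of `ℤ₂ = {±1}`, in which `-1` acts by `U₁ⁿ U₂ᵐ ↦ U₁⁻ⁿ U₂⁻ᵐ`. -/
noncomputable instance : SMul (Multiplicative (ZMod 2)) (AlgNCTorus θ) where
  smul g f := (Finsupp.mapDomain (fun p => sign g • p) f : ℤ × ℤ →₀ ℂ)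

theorem sign_smul_mono (g : Multiplicative (ZMod 2)) (p : ℤ × ℤ) (c : ℂ) :
    g • (mono p c : AlgNCTorus θ) = mono (sign g • p) c := Finsupp.mapDomain_single

protected theorem sign_smul_zero (g : Multiplicative (ZMod 2)) : g • (0 : AlgNCTorus θ) = 0 :=
  Finsupp.mapDomain_zero

protected theorem sign_smul_add (g : Multiplicative (ZMod 2)) (f f' : AlgNCTorus θ) :
    g • (f + f') = g • f + g • f' := Finsupp.mapDomain_add

noncomputable instance : MulSemiringAction (Multiplicative (ZMod 2)) (AlgNCTorus θ) where
  one_smul f := by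
    induction f using induction_mono with
    | zero => exact AlgNCTorus.sign_smul_zero _
    | add f f' hf hf' => rw [AlgNCTorus.sign_smul_add, hf, hf']
    | mono p c => simp [sign_smul_mono, sign]
  mul_smul g h f := by
    induction f using induction_mono with
    | zero => simp only [AlgNCTorus.sign_smul_zero]
    | add f f' hf hf' => simp only [AlgNCTorus.sign_smul_add, hf, hf']
    | mono p c => simp only [sign_smul_mono, sign_mul, mul_smul]
  smul_zero := AlgNCTorus.sign_smul_zero
  smul_add := AlgNCTorus.sign_smul_add
  smul_one g := by simp [one_def, sign_smul_mono]
  smul_mul g f f' := by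
    induction f using induction_mono with
    | zero => simp only [AlgNCTorus.sign_smul_zero, zero_mul]
    | add f g hf hg => simp only [AlgNCTorus.sign_smul_add, add_mul, hf, hg]
    | mono p x =>
    induction f' using induction_mono with
    | zero => simp only [AlgNCTorus.sign_smul_zero, mul_zero]
    | add f g hf hg => simp only [AlgNCTorus.sign_smul_add, mul_add, hf, hg]
    | mono q y =>
    have h : (sign g * p.2) * (sign g * q.1) = p.2 * q.1 := by
      rw [mul_mul_mul_comm, sign_mul_self, one_mul]
    simp only [mono_mul_mono, sign_smul_mono, smul_add, Prod.smul_fst, Prod.smul_snd,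
      smul_eq_mul, h]

instance : SMulCommClass (Multiplicative (ZMod 2)) ℂ (AlgNCTorus θ) where
  smul_comm g c f := by
    induction f using induction_mono with
    | zero => simp
    | add f f' hf hf' => simp only [smul_add, hf, hf']
    | mono p x => simp only [smul_mono, sign_smul_mono]

end AlgNCTorus

/-- The algebraic `ℤ₂` toroidal orbifold, i.e. the crossed product of the algebraic
noncommutative torus by `ℤ₂`: finite sums `∑ a_g g` with `(a g)(b h) = a (g • b) g h`. -/
abbrev TorusOrbifold (θ : ℝ) : Type :=
  SkewMonoidAlgebra (AlgNCTorus θ) (Multiplicative (ZMod 2))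

end Torus

/-! Write `q = halfParam θ` and `s = flip θ`. In the Weyl-ordered basis `weyl θ p g` all products
are explicit: exponents add up to the sign of `g`, and the scalar is a power of `q` given by the
symplectic form `sympl`. Equations for functionals on the algebra therefore become scalar equations
on `ℤ²`, one family in the torus sector (`g = 1`) and one in the flip sector (`g = flipElt`). In the
torus sector the generators act by scalars such as `q ^ b - q ^ (-b)`, which vanish only at resonant
exponents because `θ` is irrational. In the flip sector commutators are differences with step two,
solvable in each direction.

Degree 0 consists of traces. A trace vanishes on torus monomials other than `1`, and in the flip
sector it depends only on `p` modulo `2`: this gives `1 + 4` parameters.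

Degree 1 consists of derivations modulo inner ones. By `exists_commutator_potential` a derivation
agrees on `u₁`, `u₂` with an inner one once its values `D(u₁)(u₁⁻¹)` and `D(u₂)(u₂⁻¹)` vanish. They
do, since each Weyl monomial is a product of two involutions and `D(v)(v) = 0` for an involution
`v`. The remaining freedom, the value at `s`, is removed using `1/2`.

In degree 2 a cocycle defines a square-zero extension of the algebra, and it is a coboundary if the
extension splits. By `exists_section_of_lifts` it suffices to lift `u₁`, `u₂` so that their relation
persists. By `exists_commutator_correction` the only obstruction is one number, `fundamentalEval`.
This number vanishes on coboundaries and is nonzero on the cocycle built from the area form and the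
canonical trace, so the quotient is one-dimensional. -/

namespace DualBimodule

variable {k A : Type*} [CommRing k] [Ring A] [Algebra k A]

@[ext] theorem ext {φ ψ : DualBimodule k A} (h : ∀ x, φ x = ψ x) : φ = ψ := LinearMap.ext h

theorem map_smul (φ : DualBimodule k A) (c : k) (x : A) : φ (c • x) = c * φ x :=
  LinearMap.map_smul (show Module.Dual k A from φ) c x

theorem add_apply (φ ψ : DualBimodule k A) (x : A) : (φ + ψ) x = φ x + ψ x := rfl

theorem sub_apply (φ ψ : DualBimodule k A) (x : A) : (φ - ψ) x = φ x - ψ x := rfl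

theorem neg_apply (φ : DualBimodule k A) (x : A) : (-φ) x = -φ x := rfl

theorem zero_apply (x : A) : (0 : DualBimodule k A) x = 0 := rfl

theorem smul_scalar_apply (c : k) (φ : DualBimodule k A) (x : A) : (c • φ) x = c * φ x := rfl

end DualBimodule

/-! ### The Weyl basis of the orbifold algebra -/

namespace AlgNCTorus

/-- The square root `e^{π i θ}` of the deformation parameter. -/
noncomputable def halfParam (θ : ℝ) : ℂ := Complex.exp (Real.pi * Complex.I * θ)

theorem halfParam_ne_zero (θ : ℝ) : halfParam θ ≠ 0 := Complex.exp_ne_zero _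

theorem halfParam_zpow_two_mul (θ : ℝ) (n : ℤ) : halfParam θ ^ (2 * n) = torusParam θ ^ n := by
  rw [zpow_mul]
  congr 1
  rw [halfParam, torusParam, zpow_ofNat, ← Complex.exp_nat_mul]
  congr 1
  push_cast
  ring

/-- If `e^{π i θ n} = 1`, then `n θ` is an even integer, which irrationality excludes for `n ≠ 0`.
Every nonvanishing of a denominator below rests on this. -/
theorem halfParam_zpow_eq_one_iff {θ : ℝ} (hθ : Irrational θ) (n : ℤ) :
    halfParam θ ^ n = 1 ↔ n = 0 := by
  refine ⟨fun h => ?_, fun h => by simp [h]⟩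
  rw [halfParam, ← Complex.exp_int_mul, Complex.exp_eq_one_iff] at h
  obtain ⟨m, hm⟩ := h
  by_contra hn
  have h1 : (n : ℂ) * θ = 2 * m := by
    have : (Real.pi * Complex.I : ℂ) ≠ 0 := by
      simp [Real.pi_ne_zero]
    apply mul_left_cancel₀ this
    linear_combination hm
  have h2 : (n : ℝ) * θ = (2 * m : ℤ) := by
    have h3 : ((n * θ : ℝ) : ℂ) = ((2 * m : ℝ) : ℂ) := by
      push_cast
      exact h1
    push_cast
    exact Complex.ofReal_injective h3
  exact ((irrational_intCast_mul_iff).2 ⟨hn, hθ⟩).ne_int _ h2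

theorem halfParam_zpow_sub_ne_zero {θ : ℝ} (hθ : Irrational θ) {m n : ℤ} (h : m ≠ n) :
    halfParam θ ^ m - halfParam θ ^ n ≠ 0 := by
  intro h'
  have : halfParam θ ^ (m - n) = 1 := by
    rw [zpow_sub₀ (halfParam_ne_zero θ), sub_eq_zero.1 h',
      div_self (zpow_ne_zero _ (halfParam_ne_zero θ))]
  exact h (sub_eq_zero.1 ((halfParam_zpow_eq_one_iff hθ _).1 this))

/-- The generator of `ℤ₂`. -/
def flipElt : Multiplicative (ZMod 2) := Multiplicative.ofAdd 1

theorem flipElt_mul_self : flipElt * flipElt = 1 := by decide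

theorem flipElt_ne_one : flipElt ≠ 1 := by decide

theorem eq_one_or_eq_flipElt (g : Multiplicative (ZMod 2)) : g = 1 ∨ g = flipElt := by
  revert g; decide

@[simp] theorem sign_one : sign (1 : Multiplicative (ZMod 2)) = 1 := rfl

@[simp] theorem sign_flipElt : sign flipElt = -1 := rfl

/-- The standard symplectic form on `ℤ²`. -/
def sympl (p q : ℤ × ℤ) : ℤ := p.2 * q.1 - p.1 * q.2

/-- The Weyl-ordered elements `e^{π i θ n m} U₁ⁿ U₂ᵐ g` of the orbifold algebra. -/
noncomputable def weyl (θ : ℝ) (p : ℤ × ℤ) (g : Multiplicative (ZMod 2)) : TorusOrbifold θ :=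
  SkewMonoidAlgebra.single g (mono p (halfParam θ ^ (p.1 * p.2)))

variable {θ : ℝ}

/-- The normalisation by `q ^ (n m)` turns the asymmetric factor `λ ^ (m r)` into the antisymmetric
exponent `sympl`, and it is unchanged under `p ↦ -p`, so conjugation by the flip introduces no
scalar. -/
theorem weyl_mul (p q : ℤ × ℤ) (g h : Multiplicative (ZMod 2)) :
    weyl θ p g * weyl θ q h =
      halfParam θ ^ sympl p (sign g • q) • weyl θ (p + sign g • q) (g * h) := by
  have h0 := halfParam_ne_zero θ
  rw [weyl, weyl, weyl, SkewMonoidAlgebra.single_mul_single, sign_smul_mono, mono_mul_mono,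
    SkewMonoidAlgebra.smul_single, smul_mono, ← halfParam_zpow_two_mul, ← zpow_add₀ h0,
    ← zpow_add₀ h0, ← zpow_add₀ h0]
  have hs := sign_mul_self g
  congr 3
  simp only [sympl, Prod.smul_fst, Prod.smul_snd, smul_eq_mul, Prod.fst_add, Prod.snd_add]
  linear_combination (- q.1 * q.2) * hs

theorem weyl_one_mul (p q : ℤ × ℤ) (h : Multiplicative (ZMod 2)) :
    weyl θ p 1 * weyl θ q h = halfParam θ ^ sympl p q • weyl θ (p + q) h := by
  rw [weyl_mul]; simp

theorem weyl_zero_one : weyl θ 0 1 = 1 := by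
  simp [weyl, SkewMonoidAlgebra.one_def, AlgNCTorus.one_def]

variable (θ) in
/-- The coefficients of an element of the noncommutative torus. -/
noncomputable def coeffEquiv : AlgNCTorus θ ≃ₗ[ℂ] (ℤ × ℤ →₀ ℂ) := LinearEquiv.refl ℂ (ℤ × ℤ →₀ ℂ)

variable (θ) in
/-- The Weyl-ordered elements form a basis of the orbifold algebra. -/
noncomputable def weylBasis :
    Module.Basis (Multiplicative (ZMod 2) × (ℤ × ℤ)) ℂ (TorusOrbifold θ) :=
  (Module.Basis.ofRepr ((SkewMonoidAlgebra.coeffLinearEquiv (S := ℂ)).trans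
    ((Finsupp.mapRange.linearEquiv (coeffEquiv θ)).trans
      (Finsupp.curryLinearEquiv ℂ).symm))).unitsSMul
    fun i => Units.mk0 (halfParam θ ^ (i.2.1 * i.2.2)) (zpow_ne_zero _ (halfParam_ne_zero θ))

theorem weylBasis_apply (p : ℤ × ℤ) (g : Multiplicative (ZMod 2)) :
    weylBasis θ (g, p) = weyl θ p g := by
  rw [weylBasis, Module.Basis.unitsSMul_apply, Module.Basis.coe_ofRepr]
  have h : (SkewMonoidAlgebra.coeffLinearEquiv (S := ℂ)).trans
      ((Finsupp.mapRange.linearEquiv (coeffEquiv θ)).trans (Finsupp.curryLinearEquiv ℂ).symm)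
      (SkewMonoidAlgebra.single g (mono p 1)) = Finsupp.single (g, p) 1 := by
    rw [LinearEquiv.trans_apply, LinearEquiv.trans_apply, LinearEquiv.symm_apply_eq]
    have h1 : Finsupp.curryLinearEquiv ℂ (Finsupp.single (g, p) (1 : ℂ)) =
        Finsupp.single g (Finsupp.single p 1) := Finsupp.curry_single _ _
    rw [h1]
    exact Finsupp.mapRange_single (hf := map_zero _)
  beta_reduce
  rw [← h, LinearEquiv.symm_apply_apply, Units.smul_mk0, SkewMonoidAlgebra.smul_single, smul_mono,
    mul_one, weyl]

/-- Linear maps on the orbifold algebra are determined by their values on the Weyl basis. -/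
theorem weyl_linearMap_ext {N : Type*} [AddCommMonoid N] [Module ℂ N]
    {f g : TorusOrbifold θ →ₗ[ℂ] N} (h : ∀ p s, f (weyl θ p s) = g (weyl θ p s)) : f = g :=
  (weylBasis θ).ext fun i => by rw [← Prod.mk.eta (p := i), weylBasis_apply, h]

/-- Bilinear maps on the orbifold algebra are determined by their values on the Weyl basis. -/
theorem weyl_bilin_ext {N : Type*} [AddCommMonoid N] [Module ℂ N]
    {f g : TorusOrbifold θ →ₗ[ℂ] TorusOrbifold θ →ₗ[ℂ] N}
    (h : ∀ p s q t, f (weyl θ p s) (weyl θ q t) = g (weyl θ p s) (weyl θ q t)) : f = g :=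
  weyl_linearMap_ext fun p s => weyl_linearMap_ext fun q t => h p s q t

/-- The linear map with prescribed values on the Weyl basis. -/
noncomputable def weylLift {N : Type*} [AddCommMonoid N] [Module ℂ N]
    (F : ℤ × ℤ → Multiplicative (ZMod 2) → N) : TorusOrbifold θ →ₗ[ℂ] N :=
  (weylBasis θ).constr ℂ fun i => F i.2 i.1

theorem weylLift_weyl {N : Type*} [AddCommMonoid N] [Module ℂ N]
    (F : ℤ × ℤ → Multiplicative (ZMod 2) → N) (p : ℤ × ℤ) (g : Multiplicative (ZMod 2)) :
    weylLift F (weyl θ p g) = F p g := by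
  rw [weylLift, ← weylBasis_apply, Module.Basis.constr_basis]


theorem weyl_dual_ext {φ ψ : DualBimodule ℂ (TorusOrbifold θ)}
    (h : ∀ p g, φ (weyl θ p g) = ψ (weyl θ p g)) : φ = ψ :=
  weyl_linearMap_ext (N := ℂ) h

/-- The functional with prescribed values on the Weyl basis. -/
noncomputable def weylDual (F : ℤ × ℤ → Multiplicative (ZMod 2) → ℂ) :
    DualBimodule ℂ (TorusOrbifold θ) := weylLift (N := ℂ) F

theorem weylDual_weyl (F : ℤ × ℤ → Multiplicative (ZMod 2) → ℂ) (p : ℤ × ℤ)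
    (g : Multiplicative (ZMod 2)) : weylDual F (weyl θ p g) = F p g :=
  weylLift_weyl (N := ℂ) F p g

end AlgNCTorus

/-! ### Difference equations on `ℤ` and `ℤ²` -/

/-- A two-step recurrence on `ℤ` is solvable. -/
theorem exists_two_step_recurrence {K : Type*} [Field K] {a b : K} (ha : a ≠ 0) (hb : b ≠ 0)
    (g : ℤ → K) : ∃ y : ℤ → K, ∀ n, a * y (n - 1) - b * y (n + 1) = g n := by
  have one_step : ∀ g : ℤ → K, ∃ y : ℤ → K, ∀ n, a * y n - b * y (n + 1) = g n := by
    intro g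
    -- Start from the value `0` at `0` and solve forwards by dividing by `b`, backwards by dividing
    -- by `a`.
    let up : ℕ → K := fun n => n.rec 0 fun k y => b⁻¹ * (a * y - g k)
    let down : ℕ → K := fun n => n.rec 0 fun k y => a⁻¹ * (b * y + g (-(k + 1 : ℕ)))
    refine ⟨fun n => if 0 ≤ n then up n.toNat else down (-n).toNat, fun n => ?_⟩
    obtain ⟨k, rfl | rfl⟩ : ∃ k : ℕ, n = k ∨ n = -(k + 1 : ℕ) := by
      rcases le_or_gt 0 n with h | h
      · exact ⟨n.toNat, Or.inl (by omega)⟩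
      · exact ⟨(-n - 1).toNat, Or.inr (by omega)⟩
    · beta_reduce
      have h1 : ((k : ℤ) + 1).toNat = k + 1 := by omega
      have h2 : up (k + 1) = b⁻¹ * (a * up k - g k) := rfl
      rw [if_pos (by omega), if_pos (by omega), h1, Int.toNat_natCast, h2]
      field_simp
      ring
    · beta_reduce
      have h1 : (-(-((k + 1 : ℕ) : ℤ))).toNat = k + 1 := by omega
      have h2 : down (k + 1) = a⁻¹ * (b * down k + g (-(k + 1 : ℕ))) := rfl
      have h3 : (if 0 ≤ -((k + 1 : ℕ) : ℤ) + 1 then up (-((k + 1 : ℕ) : ℤ) + 1).toNat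
          else down (-(-((k + 1 : ℕ) : ℤ) + 1)).toNat) = down k := by
        split_ifs with h
        · obtain rfl : k = 0 := by omega
          rfl
        · congr 1
          omega
      rw [if_neg (by omega), h1, h3, h2]
      field_simp
      ring
  -- The equation at even `n` involves only odd-indexed values of `y`, and conversely, so it
  -- decouples into two one-step recurrences.
  obtain ⟨y₀, h₀⟩ := one_step fun k => g (2 * k)
  obtain ⟨y₁, h₁⟩ := one_step fun k => g (2 * k - 1)
  refine ⟨fun n => if n % 2 = 0 then y₁ (n / 2 + 1) else y₀ ((n + 1) / 2), fun n => ?_⟩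
  beta_reduce
  rcases Int.emod_two_eq_zero_or_one n with h | h
  · have := h₀ (n / 2)
    rw [if_neg (by omega), if_neg (by omega), show (n - 1 + 1) / 2 = n / 2 by omega,
      show (n + 1 + 1) / 2 = n / 2 + 1 by omega, this]
    congr 1
    omega
  · have := h₁ ((n - 1) / 2 + 1)
    rw [if_pos (by omega), if_pos (by omega), show (n + 1) / 2 = (n - 1) / 2 + 1 by omega, this]
    congr 1
    omega

/-- The two-step Koszul complex of functions on `ℤ²` is exact in the middle. -/
theorem exists_two_step_potential {K : Type*} [Field K] (X₁ X₂ : ℤ → ℤ → K)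
    (h : ∀ a b, X₁ a (b - 1) - X₁ a (b + 1) = X₂ (a - 1) b - X₂ (a + 1) b) :
    ∃ φ : ℤ → ℤ → K, (∀ a b, φ (a - 1) b - φ (a + 1) b = X₁ a b) ∧
      ∀ a b, φ a (b - 1) - φ a (b + 1) = X₂ a b := by
  -- `P` is one fixed solution operator: equal right-hand sides receive equal solutions.
  choose P hP using fun g : ℤ → K =>
    exists_two_step_recurrence (one_ne_zero (α := K)) (one_ne_zero (α := K)) g
  simp only [one_mul] at hP
  let φ₀ : ℤ → ℤ → K := fun a b => P (fun a' => X₁ a' b) a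
  let R : ℤ → ℤ → K := fun a b => X₂ a b - (φ₀ a (b - 1) - φ₀ a (b + 1))
  have hφ₀ : ∀ a b, φ₀ (a - 1) b - φ₀ (a + 1) b = X₁ a b := fun a b => hP _ a
  have hR : ∀ a, R (a - 1) = R (a + 1) := fun a => by
    ext b
    linear_combination -h a b + hφ₀ a (b + 1) - hφ₀ a (b - 1)
  -- By compatibility the residual `R` is 2-periodic in `a`, hence so is `P (R a)`. Adding it
  -- repairs the second equation without disturbing the first.
  refine ⟨fun a b => φ₀ a b + P (R a) b, fun a b => ?_, fun a b => ?_⟩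
  · simp only [hR a]
    linear_combination hφ₀ a b
  · linear_combination hP (R a) b

/-! ### Commutator equations with the generators -/

namespace AlgNCTorus

variable (θ : ℝ)

/-- The generator `U₁` of the orbifold algebra. -/
noncomputable def u₁ : TorusOrbifold θ := weyl θ (1, 0) 1

/-- The generator `U₂` of the orbifold algebra. -/
noncomputable def u₂ : TorusOrbifold θ := weyl θ (0, 1) 1

/-- The generator of the group `ℤ₂` in the orbifold algebra. -/
noncomputable def flip : TorusOrbifold θ := weyl θ 0 flipElt

variable {θ}

theorem u₁_mul_weyl (a b : ℤ) (g : Multiplicative (ZMod 2)) :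
    u₁ θ * weyl θ (a, b) g = halfParam θ ^ (-b) • weyl θ (a + 1, b) g := by
  rw [u₁, weyl_one_mul]
  simp [sympl, add_comm]

theorem u₂_mul_weyl (a b : ℤ) (g : Multiplicative (ZMod 2)) :
    u₂ θ * weyl θ (a, b) g = halfParam θ ^ a • weyl θ (a, b + 1) g := by
  rw [u₂, weyl_one_mul]
  simp [sympl, add_comm]

theorem weyl_mul_u₁ (a b : ℤ) :
    weyl θ (a, b) 1 * u₁ θ = halfParam θ ^ b • weyl θ (a + 1, b) 1 := by
  rw [u₁, weyl_one_mul]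
  simp [sympl]

theorem weyl_mul_u₂ (a b : ℤ) :
    weyl θ (a, b) 1 * u₂ θ = halfParam θ ^ (-a) • weyl θ (a, b + 1) 1 := by
  rw [u₂, weyl_one_mul]
  simp [sympl]

theorem weyl_flip_mul_u₁ (a b : ℤ) :
    weyl θ (a, b) flipElt * u₁ θ = halfParam θ ^ (-b) • weyl θ (a - 1, b) flipElt := by
  rw [u₁, weyl_mul]
  simp [sympl, sub_eq_add_neg]

theorem weyl_flip_mul_u₂ (a b : ℤ) :
    weyl θ (a, b) flipElt * u₂ θ = halfParam θ ^ a • weyl θ (a, b - 1) flipElt := by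
  rw [u₂, weyl_mul]
  simp [sympl, sub_eq_add_neg]

theorem flip_mul_weyl (p : ℤ × ℤ) (g : Multiplicative (ZMod 2)) :
    flip θ * weyl θ p g = weyl θ (-p) (flipElt * g) := by
  rw [flip, weyl_mul]
  simp [sympl]

theorem weyl_mul_flip (p : ℤ × ℤ) (g : Multiplicative (ZMod 2)) :
    weyl θ p g * flip θ = weyl θ p (g * flipElt) := by
  rw [flip, weyl_mul]
  simp [sympl]

theorem flip_mul_flip : flip θ * flip θ = 1 := by
  rw [flip, weyl_mul]
  simp [sympl, flipElt_mul_self, weyl_zero_one]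

theorem u₂_mul_u₁ : u₂ θ * u₁ θ = halfParam θ ^ (2 : ℤ) • (u₁ θ * u₂ θ) := by
  have h := halfParam_ne_zero θ
  rw [u₁, u₂, weyl_one_mul, weyl_one_mul, smul_smul, ← zpow_add₀ h]
  simp [sympl]

/-- The commutator equation for perturbations of `u₁` and `u₂` by functionals: the only obstruction
is the value at `u₁⁻¹ u₂⁻¹`. -/
theorem exists_commutator_correction (hθ : Irrational θ)
    (w : DualBimodule ℂ (TorusOrbifold θ)) (hw : w (weyl θ (-1, -1) 1) = 0) :
    ∃ y₁ y₂ : DualBimodule ℂ (TorusOrbifold θ),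
      w + (u₂ θ • y₁ + MulOpposite.op (u₁ θ) • y₂) -
        halfParam θ ^ (2 : ℤ) • (MulOpposite.op (u₂ θ) • y₁ + u₁ θ • y₂) = 0 := by
  have h0 := halfParam_ne_zero θ
  choose P hP using fun a : ℤ => exists_two_step_recurrence
    (zpow_ne_zero a h0) (zpow_ne_zero (2 + a) h0) fun b => -w (weyl θ (a, b) flipElt)
  -- In the torus sector `y₁` enters with coefficient `q ^ (-a) - q ^ (2 + a)`, zero only at `a =
  -- -1`, and `y₂` with `q ^ (-b) - q ^ (2 + b)`, zero only at `b = -1`. So `y₁` solves the equation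
  -- off the line `a = -1`, and `y₂`, supported at first exponent `0`, solves it on that line except
  -- at `(-1, -1)`. In the flip sector `y₁` alone suffices.
  refine ⟨weylDual fun p g => if g = 1 then
      -w (weyl θ (p.1, p.2 - 1) 1) / (halfParam θ ^ (-p.1) - halfParam θ ^ (2 + p.1))
      else P p.1 p.2,
    weylDual fun p g => if g = 1 ∧ p.1 = 0 then
      -w (weyl θ (p.1 - 1, p.2) 1) / (halfParam θ ^ (-p.2) - halfParam θ ^ (2 + p.2)) else 0,
    weyl_dual_ext ?_⟩
  rintro ⟨a, b⟩ g
  simp only [DualBimodule.add_apply, DualBimodule.sub_apply, DualBimodule.smul_scalar_apply,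
    DualBimodule.smul_apply, DualBimodule.op_smul_apply, DualBimodule.zero_apply]
  rcases eq_one_or_eq_flipElt g with rfl | rfl
  · simp only [u₁_mul_weyl, u₂_mul_weyl, weyl_mul_u₁, weyl_mul_u₂, DualBimodule.map_smul,
      weylDual_weyl, if_true, true_and, add_sub_cancel_right]
    by_cases ha : a = -1
    · subst ha
      by_cases hb : b = -1
      · subst hb
        simp [hw]
      · have := halfParam_zpow_sub_ne_zero hθ (show -b ≠ 2 + b by omega)
        rw [if_pos (by norm_num)]
        have hd := div_mul_cancel₀ (w (weyl θ (-1, b) 1)) this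
        generalize hD : halfParam θ ^ (-b) - halfParam θ ^ (2 + b) = D at *
        rw [zpow_add₀ h0] at hD
        have h2 : halfParam θ ^ (-(-1 : ℤ)) = halfParam θ ^ (2 : ℤ) * halfParam θ ^ (-1 : ℤ) := by
          rw [← zpow_add₀ h0]
          norm_num
        rw [h2]
        linear_combination - hd - w (weyl θ (-1, b) 1) / D * hD
    · have := halfParam_zpow_sub_ne_zero hθ (show -a ≠ 2 + a by omega)
      rw [if_neg (by omega)]
      have hd := div_mul_cancel₀ (w (weyl θ (a, b) 1)) this
      generalize hD : halfParam θ ^ (-a) - halfParam θ ^ (2 + a) = D at *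
      rw [zpow_add₀ h0] at hD
      linear_combination - hd - w (weyl θ (a, b) 1) / D * hD
  · simp only [u₁_mul_weyl, u₂_mul_weyl, weyl_flip_mul_u₁, weyl_flip_mul_u₂,
      DualBimodule.map_smul, weylDual_weyl, flipElt_ne_one, false_and,
      if_false]
    have := hP a b
    rw [zpow_add₀ h0] at this
    linear_combination this

/-- A compatible pair of functionals is the pair of commutators of `u₁` and `u₂` with one
functional; the only obstructions are the values at `u₁⁻¹` and `u₂⁻¹`. -/
theorem exists_commutator_potential (hθ : Irrational θ)
    (x₁ x₂ : DualBimodule ℂ (TorusOrbifold θ))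
    (h₁ : x₁ (weyl θ (-1, 0) 1) = 0) (h₂ : x₂ (weyl θ (0, -1) 1) = 0)
    (h : u₂ θ • x₁ + MulOpposite.op (u₁ θ) • x₂ =
      halfParam θ ^ (2 : ℤ) • (MulOpposite.op (u₂ θ) • x₁ + u₁ θ • x₂)) :
    ∃ φ : DualBimodule ℂ (TorusOrbifold θ),
      u₁ θ • φ - MulOpposite.op (u₁ θ) • φ = x₁ ∧
      u₂ θ • φ - MulOpposite.op (u₂ θ) • φ = x₂ := by
  have h0 := halfParam_ne_zero θ
  have compat : ∀ p g, _ := fun p g => congrArg (fun φ => φ (weyl θ p g)) h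
  simp only [DualBimodule.add_apply, DualBimodule.smul_scalar_apply,
    DualBimodule.smul_apply, DualBimodule.op_smul_apply] at compat
  -- In the flip sector each commutator is a power of `q` times a two-step difference. Dividing out
  -- those powers turns the compatibility of `x₁`, `x₂` into the closedness condition.
  obtain ⟨ψ, hψ₁, hψ₂⟩ := exists_two_step_potential
    (fun a b => halfParam θ ^ b * x₁ (weyl θ (a, b) flipElt))
    (fun a b => halfParam θ ^ (-a) * x₂ (weyl θ (a, b) flipElt)) (by
      intro a b
      have := compat (a, b) flipElt
      simp only [u₁_mul_weyl, u₂_mul_weyl, weyl_flip_mul_u₁, weyl_flip_mul_u₂,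
        DualBimodule.map_smul] at this
      simp only [zpow_add₀ h0, zpow_sub₀ h0, zpow_neg, neg_add, neg_sub] at this ⊢
      field_simp at this ⊢
      linear_combination this)
  have compat₁ : ∀ a b, (halfParam θ ^ (-a) - halfParam θ ^ a) * x₁ (weyl θ (a - 1, b) 1) =
      (halfParam θ ^ b - halfParam θ ^ (-b)) * x₂ (weyl θ (a, b - 1) 1) := by
    intro a b
    have := compat (a - 1, b - 1) 1
    simp only [u₁_mul_weyl, u₂_mul_weyl, weyl_mul_u₁, weyl_mul_u₂, DualBimodule.map_smul,
      sub_add_cancel] at this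
    simp only [zpow_sub₀ h0, zpow_neg, neg_sub] at this ⊢
    field_simp at this ⊢
    linear_combination this
  -- In the torus sector the commutators multiply by `q ^ b - q ^ (-b)` and `q ^ (-a) - q ^ a`. The
  -- first determines the functional when `b ≠ 0`, the second when `b = 0` and `a ≠ 0`. At `p = 0`
  -- the value is free; division by zero makes it `0`.
  refine ⟨weylDual fun p g => if g = 1 then
      if p.2 = 0 then x₂ (weyl θ (p.1, p.2 - 1) 1) / (halfParam θ ^ (-p.1) - halfParam θ ^ p.1)
      else x₁ (weyl θ (p.1 - 1, p.2) 1) / (halfParam θ ^ p.2 - halfParam θ ^ (-p.2))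
      else ψ p.1 p.2, weyl_dual_ext ?_, weyl_dual_ext ?_⟩
  · rintro ⟨a, b⟩ g
    simp only [DualBimodule.sub_apply, DualBimodule.smul_apply, DualBimodule.op_smul_apply]
    rcases eq_one_or_eq_flipElt g with rfl | rfl
    · simp only [u₁_mul_weyl, weyl_mul_u₁, DualBimodule.map_smul,
        weylDual_weyl, if_true, add_sub_cancel_right]
      by_cases hb : b = 0
      · subst hb
        by_cases ha : a = -1
        · subst ha
          simp [h₁]
        · have := halfParam_zpow_sub_ne_zero hθ (show -(a + 1) ≠ a + 1 by omega)
          have hc := compat₁ (a + 1) 0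
          have : x₁ (weyl θ (a, 0) 1) = 0 := by
            apply mul_left_cancel₀ this
            simpa using hc
          simp [this]
      · have := halfParam_zpow_sub_ne_zero hθ (show b ≠ -b by omega)
        rw [if_neg hb]
        field_simp
    · simp only [u₁_mul_weyl, weyl_flip_mul_u₁, DualBimodule.map_smul, weylDual_weyl,
        if_neg flipElt_ne_one, ← mul_sub, hψ₁, zpow_neg]
      field_simp
  · rintro ⟨a, b⟩ g
    simp only [DualBimodule.sub_apply, DualBimodule.smul_apply, DualBimodule.op_smul_apply]
    rcases eq_one_or_eq_flipElt g with rfl | rfl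
    · simp only [u₂_mul_weyl, weyl_mul_u₂, DualBimodule.map_smul,
        weylDual_weyl, if_true, add_sub_cancel_right]
      by_cases hb : b + 1 = 0
      · obtain rfl : b = -1 := by omega
        by_cases ha : a = 0
        · subst ha
          simp [h₂]
        · have := halfParam_zpow_sub_ne_zero hθ (show -a ≠ a by omega)
          rw [if_pos hb]
          field_simp
      · have := halfParam_zpow_sub_ne_zero hθ (show b + 1 ≠ -(b + 1) by omega)
        have hc := compat₁ a (b + 1)
        rw [if_neg hb, ← sub_mul, mul_div_assoc', hc, add_sub_cancel_right]
        field_simp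
    · simp only [u₂_mul_weyl, weyl_flip_mul_u₂, DualBimodule.map_smul, weylDual_weyl,
        if_neg flipElt_ne_one, ← mul_sub, hψ₂, zpow_neg]
      field_simp

end AlgNCTorus

/-! ### The Hochschild differential in low degrees -/

section Hochschild

variable {k A M : Type*} [CommRing k] [Ring A] [Algebra k A] [AddCommGroup M] [Module k M]
  [Module A M] [Module Aᵐᵒᵖ M] [IsScalarTower k A M] [IsScalarTower k Aᵐᵒᵖ M]

theorem hochschildD_zero_apply (f : HochschildCochain k A M 0) (a : A) :
    hochschildD k A M 0 f ![a] = a • f ![] - MulOpposite.op a • f ![] := by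
  have h : ∀ x : Fin 0 → A, f x = f ![] := fun x => congrArg f (Subsingleton.elim _ _)
  simp [hochschildD, HochschildCochain.first, HochschildCochain.last, sub_eq_add_neg, h]

theorem hochschildD_one_apply (f : HochschildCochain k A M 1) (a b : A) :
    hochschildD k A M 1 f ![a, b] =
      a • f ![b] - f ![a * b] + MulOpposite.op b • f ![a] := by
  have h1 : Fin.tail ![a, b] = ![b] := by ext i; fin_cases i; rfl
  have h2 : Fin.init ![a, b] = ![a] := by ext i; fin_cases i; rfl
  have h3 : mulAdjacent 0 ![a, b] = ![a * b] := by
    ext i; fin_cases i; rfl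
  simp [hochschildD, HochschildCochain.first, HochschildCochain.inner, HochschildCochain.last,
    sub_eq_add_neg, h1, h2, h3, Fin.last]

theorem hochschildD_two_apply (f : HochschildCochain k A M 2) (a b c : A) :
    hochschildD k A M 2 f ![a, b, c] =
      a • f ![b, c] - f ![a * b, c] + f ![a, b * c] - MulOpposite.op c • f ![a, b] := by
  have h1 : Fin.tail ![a, b, c] = ![b, c] := by ext i; fin_cases i <;> rfl
  have h2 : Fin.init ![a, b, c] = ![a, b] := by ext i; fin_cases i <;> rfl
  have h3 : mulAdjacent 0 ![a, b, c] = ![a * b, c] := by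
    ext i; fin_cases i <;> rfl
  have h4 : mulAdjacent 1 ![a, b, c] = ![a, b * c] := by
    ext i; fin_cases i <;> rfl
  simp [hochschildD, HochschildCochain.first, HochschildCochain.inner, HochschildCochain.last,
    sub_eq_add_neg, h1, h2, h3, h4, Fin.last, Fin.sum_univ_two, pow_succ]
  abel

end Hochschild

/-! ### Derivations into the dual and vanishing in degree 1 -/

namespace AlgNCTorus

variable {θ : ℝ}

theorem weyl_involution (p : ℤ × ℤ) : weyl θ p flipElt * weyl θ p flipElt = 1 := by
  rw [weyl_mul]
  simp [flipElt_mul_self, weyl_zero_one, sympl, mul_comm]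

/-- The inner derivation `a ↦ a φ - φ a`. -/
noncomputable def innerDerivation (φ : DualBimodule ℂ (TorusOrbifold θ)) :
    TorusOrbifold θ →ₗ[ℂ] DualBimodule ℂ (TorusOrbifold θ) where
  toFun a := a • φ - MulOpposite.op a • φ
  map_add' a b := by rw [MulOpposite.op_add, add_smul, add_smul]; abel
  map_smul' c a := by
    rw [MulOpposite.op_smul, smul_assoc, smul_assoc, smul_sub]; rfl

theorem innerDerivation_apply (φ : DualBimodule ℂ (TorusOrbifold θ)) (a : TorusOrbifold θ) :
    innerDerivation φ a = a • φ - MulOpposite.op a • φ := rfl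

theorem innerDerivation_mul (φ : DualBimodule ℂ (TorusOrbifold θ)) (a b : TorusOrbifold θ) :
    innerDerivation φ (a * b) =
      a • innerDerivation φ b + MulOpposite.op b • innerDerivation φ a := by
  simp only [innerDerivation_apply]
  rw [MulOpposite.op_mul, mul_smul, mul_smul, smul_sub, smul_sub, smul_comm a (MulOpposite.op b)]
  abel

section Derivation

variable {D : TorusOrbifold θ →ₗ[ℂ] DualBimodule ℂ (TorusOrbifold θ)}
  (hD : ∀ a b, D (a * b) = a • D b + MulOpposite.op b • D a)

include hD

theorem derivation_one : D 1 = 0 := by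
  have := hD 1 1
  rw [one_mul, one_smul, MulOpposite.op_one, one_smul] at this
  simpa using this

/-- Evaluating `D(v v) = D(1) = 0` at `1` gives `2 D(v)(v) = 0`. -/
theorem derivation_involution {v : TorusOrbifold θ} (hv : v * v = 1) : D v v = 0 := by
  have h := congrArg (fun φ => φ 1) (hD v v)
  simp only [hv, derivation_one hD, DualBimodule.add_apply, DualBimodule.smul_apply,
    DualBimodule.op_smul_apply, one_mul, mul_one, DualBimodule.zero_apply] at h
  linear_combination -h / 2

/-- A Weyl monomial is the product of the involutions `weyl θ p flipElt` and `flip θ`; expanding by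
the Leibniz rule leaves the value of `D` at each involution on itself. This removes both
obstructions in `exists_commutator_potential`. -/
theorem derivation_weyl_inv (p : ℤ × ℤ) : D (weyl θ p 1) (weyl θ (-p) 1) = 0 := by
  have h1 : weyl θ p 1 = weyl θ p flipElt * flip θ := by rw [weyl_mul_flip, flipElt_mul_self]
  have h2 : weyl θ (-p) 1 = flip θ * weyl θ p flipElt := by rw [flip_mul_weyl, flipElt_mul_self]
  rw [h1, hD, h2, DualBimodule.add_apply, DualBimodule.smul_apply, DualBimodule.op_smul_apply,
    mul_assoc, weyl_involution, mul_one, ← mul_assoc, flip_mul_flip, one_mul,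
    derivation_involution hD flip_mul_flip, derivation_involution hD (weyl_involution p), add_zero]

theorem derivation_mul_eq_zero {a b : TorusOrbifold θ} (ha : D a = 0) (hb : D b = 0) :
    D (a * b) = 0 := by rw [hD, ha, hb, smul_zero, smul_zero, add_zero]

theorem derivation_inv_eq_zero {a b : TorusOrbifold θ} (hab : a * b = 1) (hba : b * a = 1)
    (ha : D a = 0) : D b = 0 := by
  have h := hD a b
  rw [hab, ha, derivation_one hD, smul_zero, add_zero] at h
  rw [← one_smul (TorusOrbifold θ) (D b), ← hba, mul_smul, ← h, smul_zero]

theorem derivation_weyl_eq_zero (h₁ : D (u₁ θ) = 0) (h₂ : D (u₂ θ) = 0) (p : ℤ × ℤ) :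
    D (weyl θ p 1) = 0 := by
  have inv : ∀ q, weyl θ q 1 * weyl θ (-q) 1 = 1 := fun q => by
    rw [weyl_one_mul]; simp [sympl, weyl_zero_one, mul_comm]
  have inv' : ∀ q, weyl θ (-q) 1 * weyl θ q 1 = 1 := fun q => by
    simpa using inv (-q)
  have key : ∀ q, D (weyl θ q 1) = 0 → ∀ n : ℤ, D (weyl θ (n • q) 1) = 0 := by
    intro q hq n
    -- No scalar appears because the symplectic form vanishes on parallel vectors.
    have step : ∀ (m : ℤ) (r : ℤ × ℤ), (r = q ∨ r = -q) → weyl θ (m • q + r) 1 =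
        weyl θ (m • q) 1 * weyl θ r 1 := by
      rintro m r (rfl | rfl) <;> rw [weyl_one_mul] <;> simp [sympl] <;> ring_nf <;> simp
    induction n with
    | zero => simpa [weyl_zero_one] using derivation_one hD
    | succ n ih =>
      rw [add_smul, one_smul, step _ _ (Or.inl rfl)]
      exact derivation_mul_eq_zero hD ih hq
    | pred n ih =>
      rw [sub_smul, one_smul, sub_eq_add_neg, step _ _ (Or.inr rfl)]
      exact derivation_mul_eq_zero hD ih (derivation_inv_eq_zero hD (inv q) (inv' q) hq)
  have h := derivation_mul_eq_zero hD (key _ h₁ p.1) (key _ h₂ p.2)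
  rw [weyl_one_mul, map_smul] at h
  simpa [zpow_ne_zero _ (halfParam_ne_zero θ)] using h

/-- A derivation that vanishes on `u₁` and `u₂` is inner. -/
theorem exists_inner_of_derivation_of_eq_zero (h₁ : D (u₁ θ) = 0) (h₂ : D (u₂ θ) = 0) :
    ∃ χ : DualBimodule ℂ (TorusOrbifold θ), D = innerDerivation χ := by
  have hw := derivation_weyl_eq_zero hD h₁ h₂
  have hsw : ∀ p, flip θ * weyl θ p 1 = weyl θ (-p) 1 * flip θ := fun p => by
    rw [flip_mul_weyl, weyl_mul_flip, mul_one, one_mul]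
  have hn : ∀ p, MulOpposite.op (weyl θ p 1) • D (flip θ) = weyl θ (-p) 1 • D (flip θ) := by
    intro p
    have h := congrArg D (hsw p)
    rwa [hD, hD, hw, hw, smul_zero, smul_zero, zero_add, add_zero] at h
  have hs : flip θ • D (flip θ) = -(MulOpposite.op (flip θ) • D (flip θ)) := by
    have h := hD (flip θ) (flip θ)
    rw [flip_mul_flip, derivation_one hD] at h
    exact eq_neg_of_add_eq_zero_left h.symm
  -- Here `χ = -(1/2) D(s) s`. The anticommutation `hs` gives `s χ - χ s = D(s)`, and the twisted
  -- commutation `hn` makes `χ` commute with the torus.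
  obtain ⟨χ, hχ⟩ : ∃ χ : DualBimodule ℂ (TorusOrbifold θ),
      ∀ x, χ x = (-1 / 2) * D (flip θ) (flip θ * x) :=
    ⟨(-1 / 2 : ℂ) • MulOpposite.op (flip θ) • D (flip θ), fun x => by
      rw [DualBimodule.smul_scalar_apply, DualBimodule.op_smul_apply]⟩
  refine ⟨χ, ?_⟩
  have hχs : innerDerivation χ (flip θ) = D (flip θ) := by
    ext x
    have h := congrArg (fun φ => φ (flip θ * x)) hs
    beta_reduce at h
    rw [DualBimodule.smul_apply, DualBimodule.neg_apply, DualBimodule.op_smul_apply, ← mul_assoc,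
      flip_mul_flip, one_mul] at h
    rw [innerDerivation_apply, DualBimodule.sub_apply, DualBimodule.smul_apply,
      DualBimodule.op_smul_apply, hχ, hχ, ← mul_assoc, ← mul_assoc, flip_mul_flip, one_mul, h]
    ring
  have hχw : ∀ p, innerDerivation χ (weyl θ p 1) = 0 := by
    intro p
    ext x
    have h := congrArg (fun φ => φ (flip θ * x)) (hn (-p))
    beta_reduce at h
    rw [DualBimodule.smul_apply, DualBimodule.op_smul_apply, neg_neg, ← mul_assoc] at h
    rw [innerDerivation_apply, DualBimodule.sub_apply, DualBimodule.smul_apply,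
      DualBimodule.op_smul_apply, hχ, hχ, ← mul_assoc, ← mul_assoc, hsw p, h, sub_self,
      DualBimodule.zero_apply]
  apply weyl_linearMap_ext
  intro p g
  rcases eq_one_or_eq_flipElt g with rfl | rfl
  · rw [hw, hχw]
  · rw [← one_mul flipElt, ← weyl_mul_flip, hD, innerDerivation_mul, hw, hχw, hχs]

/-- Derivations of the orbifold algebra into its dual are inner. -/
theorem exists_inner_of_derivation (hθ : Irrational θ) :
    ∃ φ : DualBimodule ℂ (TorusOrbifold θ), ∀ a, D a = a • φ - MulOpposite.op a • φ := by
  -- The compatibility required of the two values is `D` applied to the relation between `u₂ u₁` and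
  -- `u₁ u₂`.
  obtain ⟨ψ, hψ₁, hψ₂⟩ := exists_commutator_potential hθ (D (u₁ θ)) (D (u₂ θ))
    (derivation_weyl_inv hD (1, 0)) (derivation_weyl_inv hD (0, 1)) (by
      rw [← hD, u₂_mul_u₁, map_smul, hD, add_comm])
  have hD' : ∀ a b, (D - innerDerivation ψ) (a * b) =
      a • (D - innerDerivation ψ) b + MulOpposite.op b • (D - innerDerivation ψ) a := by
    intro a b
    simp only [LinearMap.sub_apply]
    rw [hD, innerDerivation_mul, smul_sub, smul_sub]
    abel
  have h₁ : (D - innerDerivation ψ) (u₁ θ) = 0 := by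
    rw [LinearMap.sub_apply, innerDerivation_apply, hψ₁, sub_self]
  have h₂ : (D - innerDerivation ψ) (u₂ θ) = 0 := by
    rw [LinearMap.sub_apply, innerDerivation_apply, hψ₂, sub_self]
  obtain ⟨χ, hχ⟩ := exists_inner_of_derivation_of_eq_zero hD' h₁ h₂
  refine ⟨ψ + χ, fun a => ?_⟩
  rw [← innerDerivation_apply, ← sub_add_cancel D (innerDerivation ψ), hχ, LinearMap.add_apply]
  simp only [innerDerivation_apply, smul_add]
  abel

end Derivation

theorem subsingleton_hochschild_one (hθ : Irrational θ) : Subsingleton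
    (HochschildCohomology ℂ (TorusOrbifold θ) (DualBimodule ℂ (TorusOrbifold θ)) 1) := by
  rw [Submodule.Quotient.subsingleton_iff, Submodule.eq_top_iff']
  rintro ⟨f, hf⟩
  change f ∈ LinearMap.range (hochschildD ℂ _ _ 0)
  rw [LinearMap.mem_ker] at hf
  have vec : ∀ x : Fin 1 → TorusOrbifold θ, x = ![x 0] := fun x => by
    ext1 i; fin_cases i; rfl
  let D := (MultilinearMap.ofSubsingleton ℂ (TorusOrbifold θ)
    (DualBimodule ℂ (TorusOrbifold θ)) (0 : Fin 1)).symm f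
  have hDf : ∀ a, D a = f ![a] := fun a => congrArg f (vec _)
  obtain ⟨φ, hφ⟩ := exists_inner_of_derivation (D := D) (fun a b => by
    have h := hochschildD_one_apply f a b
    rw [hf, zero_apply] at h
    rw [hDf, hDf, hDf]
    rw [eq_comm, ← sub_eq_zero, h]
    abel) hθ
  refine ⟨MultilinearMap.constOfIsEmpty ℂ _ φ, ?_⟩
  ext1 x
  rw [vec x, hochschildD_zero_apply, ← hDf, hφ]
  rfl

/-! ### Traces and cohomology in degree 0 -/

section Traces

/-- Moving `u₁` or `u₂` around a monomial multiplies it by a nontrivial power of `q`: `u₁` detects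
`b ≠ 0`, and `u₂` detects `a ≠ 0` when `b = 0`. -/
theorem trace_weyl_eq_zero (hθ : Irrational θ) {φ : DualBimodule ℂ (TorusOrbifold θ)}
    (hφ : ∀ x y, φ (x * y) = φ (y * x)) {p : ℤ × ℤ} (hp : p ≠ 0) : φ (weyl θ p 1) = 0 := by
  obtain ⟨a, b⟩ := p
  have h1 := hφ (u₁ θ) (weyl θ (a - 1, b) 1)
  have h2 := hφ (u₂ θ) (weyl θ (a, b - 1) 1)
  simp only [u₁_mul_weyl, u₂_mul_weyl, weyl_mul_u₁, weyl_mul_u₂, DualBimodule.map_smul,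
    sub_add_cancel] at h1 h2
  by_cases hb : b = 0
  · have ha : a ≠ 0 := fun ha => hp (by rw [ha, hb]; rfl)
    apply mul_left_cancel₀ (halfParam_zpow_sub_ne_zero hθ (show a ≠ -a by omega))
    linear_combination h2
  · apply mul_left_cancel₀ (halfParam_zpow_sub_ne_zero hθ (show -b ≠ b by omega))
    linear_combination h1

/-- A generator passed through the flip becomes its inverse, so cyclicity compares exponents that
differ by `2`, with equal scalars on both sides. -/
theorem trace_weyl_flip {φ : DualBimodule ℂ (TorusOrbifold θ)}
    (hφ : ∀ x y, φ (x * y) = φ (y * x)) (a b : ℤ) :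
    φ (weyl θ (a, b) flipElt) = φ (weyl θ (a % 2, b % 2) flipElt) := by
  have h0 := halfParam_ne_zero θ
  have per : ∀ (F : ℤ → ℂ), (∀ n, F (n + 1) = F (n - 1)) → ∀ n, F n = F (n % 2) := by
    intro F hF n
    have hper : Function.Periodic F 2 := fun n => by
      have := hF (n + 1)
      rwa [add_assoc, add_sub_cancel_right] at this
    have := hper.int_mul (n / 2) (n % 2)
    rwa [Int.cast_id, mul_comm, Int.emod_add_mul_ediv] at this
  rw [per (fun a => φ (weyl θ (a, b) flipElt)) (fun n => ?_) a,
    per (fun b => φ (weyl θ (a % 2, b) flipElt)) (fun n => ?_) b]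
  · have h := hφ (u₂ θ) (weyl θ (a % 2, n) flipElt)
    rw [u₂_mul_weyl, weyl_flip_mul_u₂, DualBimodule.map_smul, DualBimodule.map_smul] at h
    exact mul_left_cancel₀ (zpow_ne_zero _ h0) h
  · have h := hφ (u₁ θ) (weyl θ (n, b) flipElt)
    rw [u₁_mul_weyl, weyl_flip_mul_u₁, DualBimodule.map_smul, DualBimodule.map_smul] at h
    exact mul_left_cancel₀ (zpow_ne_zero _ h0) h

/-- The trace with prescribed values on `1` and on the four classes of involutions. -/
noncomputable def orbifoldTrace (θ : ℝ) (c₀ : ℂ) (c : ℤ × ℤ → ℂ) :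
    DualBimodule ℂ (TorusOrbifold θ) :=
  weylDual fun p g => if g = 1 then if p = 0 then c₀ else 0 else c (p.1 % 2, p.2 % 2)

theorem orbifoldTrace_weyl_one (c₀ : ℂ) (c : ℤ × ℤ → ℂ) (p : ℤ × ℤ) :
    orbifoldTrace θ c₀ c (weyl θ p 1) = if p = 0 then c₀ else 0 := by
  rw [orbifoldTrace, weylDual_weyl, if_pos rfl]

theorem orbifoldTrace_weyl_flip (c₀ : ℂ) (c : ℤ × ℤ → ℂ) (p : ℤ × ℤ) :
    orbifoldTrace θ c₀ c (weyl θ p flipElt) = c (p.1 % 2, p.2 % 2) := by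
  rw [orbifoldTrace, weylDual_weyl, if_neg flipElt_ne_one]

/-- On basis elements, products landing in the torus sector contribute only at exponent `0`, where
the symplectic factors are trivial. For products landing in the flip sector the two orders have
equal scalars and exponents congruent modulo `2`. -/
theorem orbifoldTrace_mul_comm (c₀ : ℂ) (c : ℤ × ℤ → ℂ) (x y : TorusOrbifold θ) :
    orbifoldTrace θ c₀ c (x * y) = orbifoldTrace θ c₀ c (y * x) := by
  let τ : TorusOrbifold θ →ₗ[ℂ] ℂ := orbifoldTrace θ c₀ c
  suffices h : (LinearMap.mul ℂ (TorusOrbifold θ)).compr₂ τ =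
      ((LinearMap.mul ℂ (TorusOrbifold θ)).compr₂ τ).flip from
    LinearMap.congr_fun (LinearMap.congr_fun h x) y
  apply weyl_bilin_ext
  intro p g q h
  change orbifoldTrace θ c₀ c (weyl θ p g * weyl θ q h) =
    orbifoldTrace θ c₀ c (weyl θ q h * weyl θ p g)
  rw [weyl_mul, weyl_mul, DualBimodule.map_smul, DualBimodule.map_smul, orbifoldTrace,
    weylDual_weyl, weylDual_weyl]
  obtain ⟨a, b⟩ := p
  obtain ⟨a', b'⟩ := q
  rcases eq_one_or_eq_flipElt g with rfl | rfl <;> rcases eq_one_or_eq_flipElt h with rfl | rfl <;>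
    simp only [sign_one, sign_flipElt, one_mul, mul_one, flipElt_mul_self, if_true,
      if_neg flipElt_ne_one, one_smul, neg_smul, sympl, Prod.mk_add_mk, Prod.neg_mk,
      Prod.mk_eq_zero]
  · by_cases h : a + a' = 0 ∧ b + b' = 0
    · rw [if_pos h, if_pos (by omega)]
      obtain ⟨rfl, rfl⟩ : a' = -a ∧ b' = -b := by omega
      ring_nf
    · rw [if_neg h, if_neg (by omega), mul_zero, mul_zero]
  · rw [show (a + a') % 2 = (a' + -a) % 2 by omega, show (b + b') % 2 = (b' + -b) % 2 by omega]
    ring_nf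
  · rw [show (a + -a') % 2 = (a' + a) % 2 by omega, show (b + -b') % 2 = (b' + b) % 2 by omega]
    ring_nf
  · by_cases h : a + -a' = 0 ∧ b + -b' = 0
    · rw [if_pos h, if_pos (by omega)]
      obtain ⟨rfl, rfl⟩ : a' = a ∧ b' = b := by omega
      ring_nf
    · rw [if_neg h, if_neg (by omega), mul_zero, mul_zero]

theorem const_mem_hochschildCocycles {φ : DualBimodule ℂ (TorusOrbifold θ)}
    (h : ∀ x y, φ (x * y) = φ (y * x)) :
    MultilinearMap.constOfIsEmpty ℂ (fun _ : Fin 0 => TorusOrbifold θ) φ ∈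
      hochschildCocycles ℂ (TorusOrbifold θ) (DualBimodule ℂ (TorusOrbifold θ)) 0 := by
  rw [LinearMap.mem_ker]
  ext1 x
  have vec : x = ![x 0] := by ext1 i; fin_cases i; rfl
  rw [vec, hochschildD_zero_apply, zero_apply, sub_eq_zero, MultilinearMap.constOfIsEmpty_apply,
    Function.const_apply]
  ext y
  rw [DualBimodule.smul_apply, DualBimodule.op_smul_apply, h]

variable (θ) in
/-- Representatives of the classes of basis elements that support traces. -/
noncomputable def traceSupport : Fin 5 → TorusOrbifold θ :=
  ![weyl θ 0 1, weyl θ (0, 0) flipElt, weyl θ (0, 1) flipElt, weyl θ (1, 0) flipElt,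
    weyl θ (1, 1) flipElt]

theorem nonempty_hochschild_zero_equiv (hθ : Irrational θ) : Nonempty
    (HochschildCohomology ℂ (TorusOrbifold θ) (DualBimodule ℂ (TorusOrbifold θ)) 0
      ≃ₗ[ℂ] (Fin 5 → ℂ)) := by
  let ev : hochschildCocycles ℂ (TorusOrbifold θ) (DualBimodule ℂ (TorusOrbifold θ)) 0 →ₗ[ℂ]
      (Fin 5 → ℂ) :=
    { toFun := fun f i => f.1 ![] (traceSupport θ i)
      map_add' := fun f g => rfl
      map_smul' := fun c f => rfl }
  have hbot : (hochschildCoboundaries ℂ (TorusOrbifold θ)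
      (DualBimodule ℂ (TorusOrbifold θ)) 0).submoduleOf
      (hochschildCocycles ℂ (TorusOrbifold θ) (DualBimodule ℂ (TorusOrbifold θ)) 0) = ⊥ := by
    rw [hochschildCoboundaries, Submodule.submoduleOf, Submodule.comap_bot, Submodule.ker_subtype]
  refine ⟨(Submodule.quotEquivOfEqBot _ hbot).trans (LinearEquiv.ofBijective ev ⟨?_, ?_⟩)⟩
  · rw [injective_iff_map_eq_zero]
    rintro ⟨f, hf⟩ h0
    have hev : ∀ i, f ![] (traceSupport θ i) = 0 := fun i => congrFun h0 i
    have htr : ∀ x y, f ![] (x * y) = f ![] (y * x) := by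
      intro x y
      have h := hochschildD_zero_apply f y
      rw [LinearMap.mem_ker.1 hf, zero_apply, eq_comm, sub_eq_zero] at h
      rw [← DualBimodule.smul_apply, h, DualBimodule.op_smul_apply]
    have hzero : f ![] = 0 := by
      refine weyl_dual_ext fun p g => ?_
      rw [DualBimodule.zero_apply]
      rcases eq_one_or_eq_flipElt g with rfl | rfl
      · by_cases hp : p = 0
        · rw [hp]
          exact hev 0
        · exact trace_weyl_eq_zero hθ htr hp
      · rw [← Prod.mk.eta (p := p), trace_weyl_flip htr]
        rcases Int.emod_two_eq_zero_or_one p.1 with h1 | h1 <;>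
          rcases Int.emod_two_eq_zero_or_one p.2 with h2 | h2 <;> rw [h1, h2]
        exacts [hev 1, hev 2, hev 3, hev 4]
    ext1
    ext1 x
    rw [Subsingleton.elim x ![]]
    exact hzero
  · intro c
    let φ := orbifoldTrace θ (c 0) fun r =>
      if r.1 = 0 then if r.2 = 0 then c 1 else c 2 else if r.2 = 0 then c 3 else c 4
    refine ⟨⟨MultilinearMap.constOfIsEmpty ℂ _ φ, ?_⟩, ?_⟩
    · exact const_mem_hochschildCocycles (orbifoldTrace_mul_comm _ _)
    · ext i
      change φ (traceSupport θ i) = c i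
      fin_cases i
      · exact (orbifoldTrace_weyl_one _ _ _).trans (if_pos rfl)
      all_goals exact orbifoldTrace_weyl_flip _ _ _

end Traces

end AlgNCTorus

/-! ### Square-zero extensions by a Hochschild 2-cocycle -/

section Extension

variable {k A M : Type*} [CommRing k] [Ring A] [Algebra k A] [AddCommGroup M] [Module k M]
  [Module A M] [Module Aᵐᵒᵖ M]

/-- The 2-cocycle condition for a bilinear map. -/
def IsHochschildTwoCocycle (f : A →ₗ[k] A →ₗ[k] M) : Prop :=
  ∀ a b c, a • f b c - f (a * b) c + f a (b * c) - MulOpposite.op c • f a b = 0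

/-- The square-zero extension of `A` by `M` defined by a 2-cocycle, with underlying module
`A × M`. -/
def CocycleExtension {f : A →ₗ[k] A →ₗ[k] M} (_hf : IsHochschildTwoCocycle f) : Type _ := A × M

namespace CocycleExtension

variable {f : A →ₗ[k] A →ₗ[k] M} {hf : IsHochschildTwoCocycle f}

instance : AddCommGroup (CocycleExtension hf) := inferInstanceAs (AddCommGroup (A × M))

instance : Module k (CocycleExtension hf) := inferInstanceAs (Module k (A × M))

variable (hf) in
/-- The element with given components. -/
def mk (a : A) (m : M) : CocycleExtension hf := (a, m)

/-- The component in the algebra. -/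
def fst (x : CocycleExtension hf) : A := Prod.fst x

/-- The component in the bimodule. -/
def snd (x : CocycleExtension hf) : M := Prod.snd x

@[ext] theorem ext {x y : CocycleExtension hf} (h₁ : x.fst = y.fst) (h₂ : x.snd = y.snd) : x = y :=
  Prod.ext h₁ h₂

instance : Mul (CocycleExtension hf) :=
  ⟨fun x y => mk hf (x.fst * y.fst)
    (x.fst • y.snd + MulOpposite.op y.fst • x.snd + f x.fst y.fst)⟩

/-- The cocycle is not assumed normalised. Its identity gives `f(1, c) = f(1, 1) c` and `f(a, 1) = a
f(1, 1)`, which forces the correction `-f(1, 1)` in the unit. -/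
instance : One (CocycleExtension hf) := ⟨mk hf 1 (-f 1 1)⟩

@[simp] theorem fst_mk (a : A) (m : M) : (mk hf a m).fst = a := rfl
@[simp] theorem snd_mk (a : A) (m : M) : (mk hf a m).snd = m := rfl
@[simp] theorem fst_zero : (0 : CocycleExtension hf).fst = 0 := rfl
@[simp] theorem snd_zero : (0 : CocycleExtension hf).snd = 0 := rfl
@[simp] theorem fst_one : (1 : CocycleExtension hf).fst = 1 := rfl
@[simp] theorem snd_one : (1 : CocycleExtension hf).snd = -f 1 1 := rfl
@[simp] theorem fst_add (x y : CocycleExtension hf) : (x + y).fst = x.fst + y.fst := rfl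
@[simp] theorem snd_add (x y : CocycleExtension hf) : (x + y).snd = x.snd + y.snd := rfl
@[simp] theorem fst_smul (c : k) (x : CocycleExtension hf) : (c • x).fst = c • x.fst := rfl
@[simp] theorem snd_smul (c : k) (x : CocycleExtension hf) : (c • x).snd = c • x.snd := rfl
@[simp] theorem fst_mul (x y : CocycleExtension hf) : (x * y).fst = x.fst * y.fst := rfl
@[simp] theorem snd_mul (x y : CocycleExtension hf) : (x * y).snd =
    x.fst • y.snd + MulOpposite.op y.fst • x.snd + f x.fst y.fst := rfl

variable [IsScalarTower k A M] [IsScalarTower k Aᵐᵒᵖ M] [SMulCommClass A Aᵐᵒᵖ M]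

instance : Ring (CocycleExtension hf) :=
  { (inferInstance : AddCommGroup (CocycleExtension hf)) with
    zero_mul := fun x => by ext <;> simp
    mul_zero := fun x => by ext <;> simp
    left_distrib := fun x y z => by
      ext
      · simp [mul_add]
      · simp only [snd_mul, fst_add, snd_add, smul_add, add_smul, MulOpposite.op_add, map_add]
        abel
    right_distrib := fun x y z => by
      ext
      · simp [add_mul]
      · simp only [snd_mul, fst_add, snd_add, smul_add, add_smul, map_add, LinearMap.add_apply]
        abel
    mul_assoc := fun x y z => by
      ext
      · simp [mul_assoc]
      · have h := hf x.fst y.fst z.fst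
        simp only [snd_mul, fst_mul, smul_add, MulOpposite.op_mul, mul_smul]
        rw [smul_comm x.fst (MulOpposite.op z.fst) y.snd, ← sub_eq_zero, ← neg_eq_zero, ← h]
        abel
    one_mul := fun x => by
      ext
      · simp
      · have h := hf 1 1 x.fst
        simp only [one_smul, one_mul] at h
        simp only [snd_mul, fst_one, snd_one, one_smul, smul_neg]
        rw [← sub_eq_zero, ← h]
        abel
    mul_one := fun x => by
      ext
      · simp
      · have h := hf x.fst 1 1
        simp only [MulOpposite.op_one, one_smul, mul_one] at h
        simp only [snd_mul, fst_one, snd_one, one_smul, smul_neg, MulOpposite.op_one]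
        rw [← sub_eq_zero, ← neg_eq_zero, ← h]
        abel }

instance : Algebra k (CocycleExtension hf) :=
  Algebra.ofModule
    (fun c x y => by
      ext
      · simp
      · simp only [snd_mul, fst_smul, snd_smul, smul_add, smul_assoc, map_smul,
          LinearMap.smul_apply, smul_comm c (MulOpposite.op y.fst) x.snd])
    (fun c x y => by
      ext
      · simp
      · simp only [snd_mul, fst_smul, snd_smul, smul_add, smul_assoc, map_smul,
          MulOpposite.op_smul, smul_comm c x.fst y.snd])

variable (hf) in
/-- The projection onto the algebra. -/
def proj : CocycleExtension hf →ₐ[k] A :=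
  AlgHom.ofLinearMap
    { toFun := fun x : CocycleExtension hf => x.fst, map_add' := fst_add, map_smul' := fst_smul }
    (fst_one (hf := hf)) (fst_mul (hf := hf))

theorem proj_apply (x : CocycleExtension hf) : proj hf x = x.fst := rfl

theorem proj_surjective : Function.Surjective (proj hf) := fun a => ⟨mk hf a 0, rfl⟩

theorem mul_eq_zero_of_proj_eq_zero (x y : CocycleExtension hf) (hx : proj hf x = 0)
    (hy : proj hf y = 0) : x * y = 0 := by
  rw [proj_apply] at hx hy
  ext <;> simp [hx, hy]

variable (hf) in
/-- The component in the bimodule, as a linear map. -/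
def sndHom : CocycleExtension hf →ₗ[k] M where
  toFun := snd
  map_add' := snd_add
  map_smul' := snd_smul

end CocycleExtension

end Extension

/-! ### Lifting relations, units and involutions -/

/-- Powers of two group elements that commute up to a central element. -/
theorem zpow_mul_zpow_of_commutator {G : Type*} [Group G] {a b c : G} (ha : Commute c a)
    (hb : Commute c b) (h : b * a = c * (a * b)) (m r : ℤ) :
    b ^ m * a ^ r = c ^ (m * r) * (a ^ r * b ^ m) := by
  have h1 : SemiconjBy b a (c * a) := by rw [SemiconjBy, h, mul_assoc]
  have h2 : b * a ^ r = c ^ r * a ^ r * b := by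
    rw [← ha.mul_zpow]
    exact h1.zpow_right r
  have h3 : SemiconjBy (a ^ r)⁻¹ b (c ^ r * b) := by
    rw [SemiconjBy, eq_mul_inv_iff_mul_eq, mul_assoc, h2, (ha.zpow_zpow r r).eq, mul_assoc,
      inv_mul_cancel_left]
  have h4 := h3.zpow_right m
  rw [(hb.zpow_left r).mul_zpow, SemiconjBy, ← zpow_mul, inv_mul_eq_iff_eq_mul, ← mul_assoc,
    eq_mul_inv_iff_mul_eq] at h4
  rw [h4, mul_comm m r, ← mul_assoc, ← mul_assoc, (ha.zpow_zpow (r * m) r).eq]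

/-- Elements over units in a square-zero extension are units. -/
theorem isUnit_of_isUnit_map_of_sq_zero {E B : Type*} [Ring E] [Ring B] (π : E →+* B)
    (hsurj : Function.Surjective π) (hsq : ∀ x y, π x = 0 → π y = 0 → x * y = 0) {x : E}
    (hx : IsUnit (π x)) : IsUnit x := by
  have near_one : ∀ z, π z = 1 → IsUnit z := fun z hz => by
    have h0 : π (z - 1) = 0 := by rw [map_sub, hz, map_one, sub_self]
    have : IsNilpotent (z - 1) := ⟨2, by rw [pow_two, hsq _ _ h0 h0]⟩
    simpa using this.isUnit_add_one
  obtain ⟨b, hb, hb'⟩ := isUnit_iff_exists.1 hx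
  obtain ⟨y, rfl⟩ := hsurj b
  obtain ⟨c, hc, -⟩ := isUnit_iff_exists.1 (near_one (x * y) (by rw [map_mul, hb]))
  obtain ⟨d, -, hd⟩ := isUnit_iff_exists.1 (near_one (y * x) (by rw [map_mul, hb']))
  exact isUnit_iff_exists_and_exists.2 ⟨⟨y * c, by rw [← mul_assoc, hc]⟩,
    ⟨d * y, by rw [mul_assoc, hd]⟩⟩

/-- Involutions lift along square-zero extensions when `2` is invertible. -/
theorem exists_involution_lift {k E B : Type*} [Field k] [CharZero k] [Ring E] [Algebra k E]
    [Ring B] [Algebra k B] (π : E →ₐ[k] B) (hsurj : Function.Surjective π)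
    (hsq : ∀ x y, π x = 0 → π y = 0 → x * y = 0) {s : B} (hs : s * s = 1) :
    ∃ S : E, π S = s ∧ S * S = 1 := by
  obtain ⟨T, rfl⟩ := hsurj s
  -- With `T² = 1 + 2h` and `h² = 0`, the corrected lift `T (1 - h)` is `T (T²)^(-1/2)`, the series
  -- being exact at first order.
  obtain ⟨h, hh⟩ : ∃ h : E, h = (1 / 2 : k) • (T * T - 1) := ⟨_, rfl⟩
  have h1 : T * T = 1 + (h + h) := by
    rw [hh, ← add_smul]
    norm_num
  have h2 : h * T = T * h := by
    rw [hh, smul_mul_assoc, mul_smul_comm]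
    congr 1
    noncomm_ring
  have h3 : π h = 0 := by
    rw [hh, map_smul, map_sub, map_mul, hs, map_one, sub_self, smul_zero]
  have h4 := hsq h h h3 h3
  refine ⟨T * (1 - h), by rw [map_mul, map_sub, map_one, h3, sub_zero, mul_one], ?_⟩
  have h5 : (1 - h) * T = T * (1 - h) := by rw [sub_mul, mul_sub, h2, one_mul, mul_one]
  have h6 : (1 - h) * (1 - h) = 1 - (h + h) := by
    rw [sub_mul, mul_sub, mul_sub, h4]
    noncomm_ring
  have h7 : (h + h) * (h + h) = 0 := by
    rw [add_mul, mul_add, h4]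
    simp
  rw [mul_assoc, ← mul_assoc (1 - h), h5, mul_assoc, h6, ← mul_assoc, h1, add_mul, one_mul,
    mul_sub, mul_one, h7]
  abel

/-! ### Splitting square-zero extensions of the orbifold algebra -/

namespace AlgNCTorus

variable {θ : ℝ}

variable (θ) in
/-- The Weyl-ordered monomials in `U₁` and `U₂` as units. -/
noncomputable def weylUnit (p : ℤ × ℤ) : (TorusOrbifold θ)ˣ where
  val := weyl θ p 1
  inv := weyl θ (-p) 1
  val_inv := by rw [weyl_one_mul]; simp [sympl, weyl_zero_one, mul_comm]
  inv_val := by rw [weyl_one_mul]; simp [sympl, weyl_zero_one, mul_comm]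

theorem weylUnit_zpow (q : ℤ × ℤ) (n : ℤ) : weylUnit θ q ^ n = weylUnit θ (n • q) := by
  let F : Multiplicative ℤ →* (TorusOrbifold θ)ˣ :=
    { toFun := fun n => weylUnit θ (n.toAdd • q)
      map_one' := Units.ext (by
        change weyl θ ((0 : ℤ) • q) 1 = 1
        rw [zero_smul, weyl_zero_one])
      map_mul' := fun m n => Units.ext (by
        change weyl θ ((m.toAdd + n.toAdd) • q) 1 =
          weyl θ (m.toAdd • q) 1 * weyl θ (n.toAdd • q) 1
        rw [weyl_one_mul, add_smul]
        simp [sympl]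
        ring_nf
        simp) }
  have h := map_zpow F (Multiplicative.ofAdd 1) n
  change weylUnit θ ((n • (1 : ℤ)) • q) = weylUnit θ ((1 : ℤ) • q) ^ n at h
  rw [smul_eq_mul, mul_one, one_smul] at h
  exact h.symm

variable {E : Type*} [Ring E] [Algebra ℂ E]

/-- Scalars as central units. -/
noncomputable def scalarUnit (E : Type*) [Ring E] [Algebra ℂ E] (θ : ℝ) : Eˣ :=
  Units.map (algebraMap ℂ E : ℂ →* E) (Units.mk0 (halfParam θ) (halfParam_ne_zero θ))

theorem scalarUnit_zpow_mul (n : ℤ) (x : E) :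
    ((scalarUnit E θ ^ n : Eˣ) : E) * x = halfParam θ ^ n • x := by
  rw [scalarUnit, ← map_zpow, Units.coe_map, Units.val_zpow_eq_zpow_val, Units.val_mk0,
    MonoidHom.coe_coe, ← Algebra.smul_def]

theorem scalarUnit_commute (x : Eˣ) : Commute (scalarUnit E θ) x :=
  Units.ext (Algebra.commutes _ _)

/-- The Weyl-ordered monomials in two given units. -/
noncomputable def weylMonomial (θ : ℝ) (V₁ V₂ : Eˣ) (p : ℤ × ℤ) : Eˣ :=
  scalarUnit E θ ^ (p.1 * p.2) * (V₁ ^ p.1 * V₂ ^ p.2)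

/-- Moving `V₁ ^ q.1` past `V₂ ^ p.2` costs `halfParam θ ^ (2 * p.2 * q.1)`; combined with the three
normalising factors this leaves `sympl p q`. -/
theorem weylMonomial_mul {V₁ V₂ : Eˣ}
    (h : (V₂ * V₁ : E) = halfParam θ ^ (2 : ℤ) • (V₁ * V₂ : E)) (p q : ℤ × ℤ) :
    (weylMonomial θ V₁ V₂ p * weylMonomial θ V₁ V₂ q : E) =
      halfParam θ ^ sympl p q • (weylMonomial θ V₁ V₂ (p + q) : E) := by
  have hc := fun (n : ℤ) (x : Eˣ) => ((scalarUnit_commute (θ := θ) x).zpow_left n).eq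
  have hV : V₂ * V₁ = scalarUnit E θ ^ (2 : ℤ) * (V₁ * V₂) :=
    Units.ext (by
      rw [Units.val_mul, h, Units.val_mul _ (V₁ * V₂), scalarUnit_zpow_mul, Units.val_mul])
  have hz := zpow_mul_zpow_of_commutator ((scalarUnit_commute (θ := θ) V₁).zpow_left 2)
    ((scalarUnit_commute (θ := θ) V₂).zpow_left 2) hV p.2 q.1
  rw [← zpow_mul] at hz
  rw [← scalarUnit_zpow_mul, ← Units.val_mul, ← Units.val_mul]
  congr 1
  simp only [weylMonomial, Prod.fst_add, Prod.snd_add]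
  set K := scalarUnit E θ with hK
  calc K ^ (p.1 * p.2) * (V₁ ^ p.1 * V₂ ^ p.2) * (K ^ (q.1 * q.2) * (V₁ ^ q.1 * V₂ ^ q.2))
      = K ^ (p.1 * p.2) * ((V₁ ^ p.1 * V₂ ^ p.2) * K ^ (q.1 * q.2)) *
          (V₁ ^ q.1 * V₂ ^ q.2) := by group
    _ = K ^ (p.1 * p.2) * (K ^ (q.1 * q.2) * (V₁ ^ p.1 * V₂ ^ p.2)) *
          (V₁ ^ q.1 * V₂ ^ q.2) := by rw [hc _ (V₁ ^ p.1 * V₂ ^ p.2)]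
    _ = K ^ (p.1 * p.2) * K ^ (q.1 * q.2) * (V₁ ^ p.1 * (V₂ ^ p.2 * V₁ ^ q.1) * V₂ ^ q.2) := by
        group
    _ = K ^ (p.1 * p.2) * K ^ (q.1 * q.2) * ((V₁ ^ p.1 * K ^ (2 * (p.2 * q.1))) *
          (V₁ ^ q.1 * V₂ ^ p.2) * V₂ ^ q.2) := by rw [hz]; group
    _ = K ^ (p.1 * p.2) * K ^ (q.1 * q.2) * ((K ^ (2 * (p.2 * q.1)) * V₁ ^ p.1) *
          (V₁ ^ q.1 * V₂ ^ p.2) * V₂ ^ q.2) := by rw [hc _ (V₁ ^ p.1)]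
    _ = K ^ (p.1 * p.2 + q.1 * q.2 + 2 * (p.2 * q.1)) *
          ((V₁ ^ p.1 * V₁ ^ q.1) * (V₂ ^ p.2 * V₂ ^ q.2)) := by
        rw [zpow_add, zpow_add]; simp only [mul_assoc]
    _ = _ := by
        rw [← zpow_add, ← zpow_add, ← mul_assoc (K ^ sympl p q), ← zpow_add]
        congr 2
        rw [sympl]
        ring

theorem map_weylMonomial (π : E →ₐ[ℂ] TorusOrbifold θ) {V₁ V₂ : Eˣ} (h₁ : π V₁ = u₁ θ)
    (h₂ : π V₂ = u₂ θ) (p : ℤ × ℤ) : π (weylMonomial θ V₁ V₂ p) = weyl θ p 1 := by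
  have e₁ : Units.map (π : E →* TorusOrbifold θ) V₁ = weylUnit θ (1, 0) := Units.ext h₁
  have e₂ : Units.map (π : E →* TorusOrbifold θ) V₂ = weylUnit θ (0, 1) := Units.ext h₂
  have e : π (V₁ ^ p.1 * V₂ ^ p.2 : Eˣ) = weyl θ (p.1, 0) 1 * weyl θ (0, p.2) 1 := by
    change ((Units.map (π : E →* TorusOrbifold θ) (V₁ ^ p.1 * V₂ ^ p.2) : (TorusOrbifold θ)ˣ) :
      TorusOrbifold θ) = _
    rw [map_mul, map_zpow, map_zpow, e₁, e₂, weylUnit_zpow, weylUnit_zpow, Units.val_mul]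
    simp [weylUnit]
  rw [weylMonomial, Units.val_mul, scalarUnit_zpow_mul, map_smul, e, weyl_one_mul, smul_smul,
    ← zpow_add₀ (halfParam_ne_zero θ)]
  simp [sympl]

/-- A square-zero extension of the orbifold algebra splits as soon as `u₁` and `u₂` have lifts
that satisfy the defining relation. -/
theorem exists_section_of_lifts (π : E →ₐ[ℂ] TorusOrbifold θ) (hsurj : Function.Surjective π)
    (hsq : ∀ x y, π x = 0 → π y = 0 → x * y = 0) {V₁ V₂ : E} (h₁ : π V₁ = u₁ θ)
    (h₂ : π V₂ = u₂ θ) (h : V₂ * V₁ = halfParam θ ^ (2 : ℤ) • (V₁ * V₂)) :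
    ∃ σ : TorusOrbifold θ →ₗ[ℂ] E, (∀ x y, σ (x * y) = σ x * σ y) ∧ ∀ x, π (σ x) = x := by
  obtain ⟨V₁, rfl⟩ := isUnit_of_isUnit_map_of_sq_zero (π : E →+* TorusOrbifold θ) hsurj hsq
    (x := V₁) (by
      change IsUnit (π V₁)
      rw [h₁]; exact (weylUnit θ (1, 0)).isUnit)
  obtain ⟨V₂, rfl⟩ := isUnit_of_isUnit_map_of_sq_zero (π : E →+* TorusOrbifold θ) hsurj hsq
    (x := V₂) (by
      change IsUnit (π V₂)
      rw [h₂]; exact (weylUnit θ (0, 1)).isUnit)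
  obtain ⟨S, hS, hSS⟩ := exists_involution_lift π hsurj hsq (flip_mul_flip (θ := θ))
  obtain ⟨v, hv⟩ : ∃ v : ℤ × ℤ → E, v = fun p => (weylMonomial θ V₁ V₂ p : E) := ⟨_, rfl⟩
  have v_mul : ∀ p q, v p * v q = halfParam θ ^ sympl p q • v (p + q) := by
    rw [hv]; exact weylMonomial_mul h
  have map_v : ∀ p, π (v p) = weyl θ p 1 := by
    rw [hv]; exact map_weylMonomial π h₁ h₂
  -- Conjugation by `S` gives a second lift of the same Weyl system. Neither lift need be compatible
  -- with `S`, but their average is.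
  obtain ⟨w, hw⟩ : ∃ w : ℤ × ℤ → E, ∀ p, w p = S * v (-p) * S := ⟨_, fun _ => rfl⟩
  have w_mul : ∀ p q, w p * w q = halfParam θ ^ sympl p q • w (p + q) := by
    intro p q
    have e : sympl (-p) (-q) = sympl p q := by simp [sympl]
    calc w p * w q = S * v (-p) * (S * S) * v (-q) * S := by rw [hw, hw]; simp only [mul_assoc]
      _ = S * (v (-p) * v (-q)) * S := by rw [hSS]; simp only [mul_assoc, one_mul]
      _ = _ := by rw [v_mul, hw, e, neg_add, mul_smul_comm, smul_mul_assoc]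
  have map_w : ∀ p, π (w p) = weyl θ p 1 := by
    intro p
    rw [hw, map_mul, map_mul, hS, map_v, flip_mul_weyl, weyl_mul_flip, neg_neg, mul_one,
      flipElt_mul_self]
  obtain ⟨V, hV⟩ : ∃ V : ℤ × ℤ → E, ∀ p, V p = (1 / 2 : ℂ) • (v p + w p) := ⟨_, fun _ => rfl⟩
  have V_mul : ∀ p q, V p * V q = halfParam θ ^ sympl p q • V (p + q) := by
    intro p q
    -- The differences `v - w` lie in the square-zero kernel, so the mixed products satisfy `v w + w
    -- v = v v + w w`. Hence the average remains multiplicative.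
    have h0 := hsq (v p - w p) (v q - w q) (by rw [map_sub, map_v, map_w, sub_self])
      (by rw [map_sub, map_v, map_w, sub_self])
    have h1 : (v p + w p) * (v q + w q) = (2 : ℂ) • (v p * v q + w p * w q) := by
      rw [two_smul, ← sub_eq_zero, ← neg_eq_zero, ← h0]
      noncomm_ring
    rw [hV, hV, hV, smul_mul_smul_comm, h1, v_mul, w_mul, ← smul_add, smul_smul, smul_smul,
      smul_smul]
    congr 1
    ring
  have map_V : ∀ p, π (V p) = weyl θ p 1 := by
    intro p
    rw [hV, map_smul, map_add, map_v, map_w, ← two_smul ℂ, smul_smul]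
    norm_num
  have S_mul : ∀ p, S * V p = V (-p) * S := by
    intro p
    have h1 : S * w p = v (-p) * S := by
      rw [hw, ← mul_assoc, ← mul_assoc, hSS, one_mul]
    have h2 : S * v p = w (-p) * S := by
      rw [hw, neg_neg, mul_assoc _ S S, hSS, mul_one]
    rw [hV, hV, mul_smul_comm, smul_mul_assoc, mul_add, add_mul, h1, h2, add_comm]
  let R : Multiplicative (ZMod 2) → E := fun g => if g = 1 then 1 else S
  have R_one : R 1 = 1 := if_pos rfl
  have R_flip : R flipElt = S := if_neg flipElt_ne_one
  have R_mul : ∀ g h, R g * R h = R (g * h) := by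
    intro g h
    rcases eq_one_or_eq_flipElt g with rfl | rfl <;>
      rcases eq_one_or_eq_flipElt h with rfl | rfl <;>
      simp only [one_mul, mul_one, flipElt_mul_self, R_one, R_flip, hSS]
  have R_mul_V : ∀ g q, R g * V q = V (sign g • q) * R g := by
    intro g q
    rcases eq_one_or_eq_flipElt g with rfl | rfl
    · simp [R_one]
    · simp [R_flip, S_mul]
  obtain ⟨σ, hσ⟩ : ∃ σ : TorusOrbifold θ →ₗ[ℂ] E, ∀ p g, σ (weyl θ p g) = V p * R g :=
    ⟨weylLift fun p g => V p * R g, fun p g => weylLift_weyl _ _ _⟩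
  refine ⟨σ, fun x y => ?_, fun x => ?_⟩
  · suffices hmul : (LinearMap.mul ℂ (TorusOrbifold θ)).compr₂ σ =
        (LinearMap.mul ℂ E).compl₁₂ σ σ from LinearMap.congr_fun (LinearMap.congr_fun hmul x) y
    apply weyl_bilin_ext
    intro p g q h
    rw [LinearMap.compr₂_apply, LinearMap.mul_apply', LinearMap.compl₁₂_apply,
      LinearMap.mul_apply', weyl_mul, map_smul, hσ, hσ, hσ, ← R_mul, mul_assoc, ← mul_assoc (R g),
      R_mul_V, mul_assoc, ← mul_assoc (V p), V_mul, smul_mul_assoc]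
  · suffices hid : π.toLinearMap ∘ₗ σ = LinearMap.id from LinearMap.congr_fun hid x
    apply weyl_linearMap_ext
    intro p g
    rw [LinearMap.comp_apply, hσ, AlgHom.toLinearMap_apply, map_mul, map_V, LinearMap.id_apply]
    rcases eq_one_or_eq_flipElt g with rfl | rfl
    · rw [R_one, map_one, mul_one]
    · rw [R_flip, hS, weyl_mul_flip, one_mul]

end AlgNCTorus

/-! ### 2-cochains as bilinear maps -/

section Hochschild

variable {k A M : Type*} [CommRing k] [Ring A] [Algebra k A] [AddCommGroup M] [Module k M]

/-- A Hochschild 2-cochain as a bilinear map. -/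
def HochschildCochain.toBilin (f : HochschildCochain k A M 2) : A →ₗ[k] A →ₗ[k] M :=
  LinearMap.mk₂ k (fun a b => f ![a, b])
    (fun a a' b => f.cons_add ![b] a a')
    (fun c a b => f.cons_smul ![b] c a)
    (fun a b b' => (f.curryLeft a).cons_add ![] b b')
    (fun c a b => (f.curryLeft a).cons_smul ![] c b)

/-- A bilinear map as a Hochschild 2-cochain. -/
def HochschildCochain.ofBilin (F : A →ₗ[k] A →ₗ[k] M) : HochschildCochain k A M 2 :=
  LinearMap.uncurryLeft
    ((MultilinearMap.ofSubsingletonₗ k k A M (0 : Fin 1)).toLinearMap ∘ₗ F)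

theorem HochschildCochain.ofBilin_apply (F : A →ₗ[k] A →ₗ[k] M) (a b : A) :
    HochschildCochain.ofBilin F ![a, b] = F a b := rfl

end Hochschild

namespace AlgNCTorus

variable {θ : ℝ}

/-! ### The fundamental 2-cocycle -/

variable (θ) in
/-- The diagonal map on the Weyl basis with the given eigenvalues. -/
noncomputable def weylDiag (c : ℤ × ℤ → Multiplicative (ZMod 2) → ℂ) :
    TorusOrbifold θ →ₗ[ℂ] TorusOrbifold θ :=
  weylLift fun p g => c p g • weyl θ p g

theorem weylDiag_weyl (c : ℤ × ℤ → Multiplicative (ZMod 2) → ℂ) (p : ℤ × ℤ)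
    (g : Multiplicative (ZMod 2)) : weylDiag θ c (weyl θ p g) = c p g • weyl θ p g :=
  weylLift_weyl _ _ _

variable (θ) in
/-- The grading automorphism, `1` on the torus and `-1` on its complement. -/
noncomputable def gradeMap : TorusOrbifold θ →ₗ[ℂ] TorusOrbifold θ :=
  weylDiag θ fun _ g => sign g

variable (θ) in
/-- The twisted derivation that multiplies `U₁ⁿ U₂ᵐ g` by `ℓ (n, m)`. -/
noncomputable def degreeMap (ℓ : ℤ × ℤ →+ ℤ) : TorusOrbifold θ →ₗ[ℂ] TorusOrbifold θ :=
  weylDiag θ fun p _ => ℓ p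

theorem gradeMap_mul (x y : TorusOrbifold θ) :
    gradeMap θ (x * y) = gradeMap θ x * gradeMap θ y := by
  suffices h : (LinearMap.mul ℂ (TorusOrbifold θ)).compr₂ (gradeMap θ) =
      (LinearMap.mul ℂ (TorusOrbifold θ)).compl₁₂ (gradeMap θ) (gradeMap θ) from
    LinearMap.congr_fun (LinearMap.congr_fun h x) y
  apply weyl_bilin_ext
  intro p g q h
  rw [LinearMap.compr₂_apply, LinearMap.mul_apply', LinearMap.compl₁₂_apply, LinearMap.mul_apply',
    weyl_mul, map_smul, gradeMap, weylDiag_weyl, weylDiag_weyl, weylDiag_weyl,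
    smul_mul_smul_comm, weyl_mul, smul_comm, sign_mul, Int.cast_mul]

theorem gradeMap_gradeMap (x : TorusOrbifold θ) : gradeMap θ (gradeMap θ x) = x := by
  suffices h : gradeMap θ ∘ₗ gradeMap θ = LinearMap.id from LinearMap.congr_fun h x
  apply weyl_linearMap_ext
  intro p g
  rw [LinearMap.comp_apply, gradeMap, weylDiag_weyl, map_smul, weylDiag_weyl, smul_smul,
    ← Int.cast_mul, sign_mul_self, Int.cast_one, one_smul, LinearMap.id_apply]

/-- The exponent of a product is `p + sign g • q`, so an additive `ℓ` obeys a Leibniz rule twisted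
by the grading automorphism. -/
theorem degreeMap_mul (ℓ : ℤ × ℤ →+ ℤ) (x y : TorusOrbifold θ) :
    degreeMap θ ℓ (x * y) = degreeMap θ ℓ x * y + gradeMap θ x * degreeMap θ ℓ y := by
  suffices h : (LinearMap.mul ℂ (TorusOrbifold θ)).compr₂ (degreeMap θ ℓ) =
      (LinearMap.mul ℂ (TorusOrbifold θ)).compl₁₂ (degreeMap θ ℓ) LinearMap.id +
        (LinearMap.mul ℂ (TorusOrbifold θ)).compl₁₂ (gradeMap θ) (degreeMap θ ℓ) from
    LinearMap.congr_fun (LinearMap.congr_fun h x) y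
  apply weyl_bilin_ext
  intro p g q h
  rw [LinearMap.add_apply, LinearMap.add_apply, LinearMap.compr₂_apply, LinearMap.mul_apply',
    LinearMap.compl₁₂_apply, LinearMap.mul_apply', LinearMap.compl₁₂_apply, LinearMap.mul_apply',
    LinearMap.id_apply, weyl_mul, map_smul, gradeMap, degreeMap, weylDiag_weyl, weylDiag_weyl,
    weylDiag_weyl, weylDiag_weyl, smul_mul_smul_comm, smul_mul_assoc, weyl_mul, ← add_smul,
    smul_comm, map_add, map_zsmul, smul_eq_mul, Int.cast_add, Int.cast_mul]

variable (θ) in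
/-- The bilinear map `(U₁ⁿ U₂ᵐ g, U₁ʳ U₂ˢ h) ↦ det((n, m), g (r, s)) · U₁ⁿ U₂ᵐ g U₁ʳ U₂ˢ h`, up to
sign. -/
noncomputable def areaMap : TorusOrbifold θ →ₗ[ℂ] TorusOrbifold θ →ₗ[ℂ] TorusOrbifold θ :=
  (LinearMap.mul ℂ (TorusOrbifold θ)).compl₁₂
      (degreeMap θ (AddMonoidHom.snd ℤ ℤ) ∘ₗ gradeMap θ) (degreeMap θ (AddMonoidHom.fst ℤ ℤ)) -
    (LinearMap.mul ℂ (TorusOrbifold θ)).compl₁₂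
      (degreeMap θ (AddMonoidHom.fst ℤ ℤ) ∘ₗ gradeMap θ) (degreeMap θ (AddMonoidHom.snd ℤ ℤ))

theorem areaMap_apply (x y : TorusOrbifold θ) : areaMap θ x y =
    degreeMap θ (AddMonoidHom.snd ℤ ℤ) (gradeMap θ x) * degreeMap θ (AddMonoidHom.fst ℤ ℤ) y -
    degreeMap θ (AddMonoidHom.fst ℤ ℤ) (gradeMap θ x) * degreeMap θ (AddMonoidHom.snd ℤ ℤ) y :=
  rfl

/-- `areaMap` is an antisymmetrised cup product of twisted derivations. Precomposing the left factor
with the involutive `gradeMap` makes the two twists cancel. -/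
theorem areaMap_cocycle (x y z : TorusOrbifold θ) :
    x * areaMap θ y z - areaMap θ (x * y) z + areaMap θ x (y * z) - areaMap θ x y * z = 0 := by
  simp only [areaMap_apply, gradeMap_mul, degreeMap_mul, gradeMap_gradeMap]
  noncomm_ring

variable (θ) in
/-- The functional-valued fundamental cocycle `(x, y) ↦ τ(areaMap x y ·)`. -/
noncomputable def fundamentalCocycle :
    TorusOrbifold θ →ₗ[ℂ] TorusOrbifold θ →ₗ[ℂ] DualBimodule ℂ (TorusOrbifold θ) :=
  (areaMap θ).compr₂
    { toFun := fun y => MulOpposite.op y • orbifoldTrace θ 1 0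
      map_add' := fun y z => by rw [MulOpposite.op_add, add_smul]
      map_smul' := fun c y => by rw [MulOpposite.op_smul, smul_assoc]; rfl }

theorem fundamentalCocycle_apply (x y z : TorusOrbifold θ) :
    fundamentalCocycle θ x y z = orbifoldTrace θ 1 0 (areaMap θ x y * z) := by
  change (MulOpposite.op (areaMap θ x y) • orbifoldTrace θ 1 0) z = _
  rw [DualBimodule.op_smul_apply]

/-- Cyclicity of the trace moves the left action to the front of the product, reducing the claim to
`areaMap_cocycle`. -/
theorem isHochschildTwoCocycle_fundamentalCocycle :
    IsHochschildTwoCocycle (fundamentalCocycle θ) := by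
  intro x y z
  ext w
  rw [DualBimodule.sub_apply, DualBimodule.add_apply, DualBimodule.sub_apply,
    DualBimodule.smul_apply, DualBimodule.op_smul_apply, fundamentalCocycle_apply,
    fundamentalCocycle_apply, fundamentalCocycle_apply, fundamentalCocycle_apply, ← mul_assoc,
    orbifoldTrace_mul_comm 1 0 (areaMap θ y z * w) x, ← mul_assoc]
  let τ : TorusOrbifold θ →ₗ[ℂ] ℂ := orbifoldTrace θ 1 0
  change τ _ - τ _ + τ _ - τ _ = 0
  rw [← map_sub, ← map_add, ← map_sub, ← sub_mul, ← add_mul, ← mul_assoc, ← sub_mul,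
    areaMap_cocycle, zero_mul, map_zero]

/-! ### The second Hochschild cohomology -/

variable (θ) in
/-- Evaluation of a 2-cochain on the fundamental Hochschild cycle. -/
noncomputable def fundamentalEval :
    HochschildCochain ℂ (TorusOrbifold θ) (DualBimodule ℂ (TorusOrbifold θ)) 2 →ₗ[ℂ] ℂ where
  toFun f := f ![u₂ θ, u₁ θ] (weyl θ (-1, -1) 1) -
    halfParam θ ^ (2 : ℤ) * f ![u₁ θ, u₂ θ] (weyl θ (-1, -1) 1)
  map_add' f g := by
    have h : ∀ v, (f + g) v = f v + g v := fun _ => rfl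
    rw [h, h, DualBimodule.add_apply, DualBimodule.add_apply]
    ring
  map_smul' c f := by
    have h : ∀ v, (c • f) v = c • f v := fun _ => rfl
    rw [h, h, DualBimodule.smul_scalar_apply,
      DualBimodule.smul_scalar_apply, smul_eq_mul, RingHom.id_apply]
    ring

theorem fundamentalEval_apply
    (f : HochschildCochain ℂ (TorusOrbifold θ) (DualBimodule ℂ (TorusOrbifold θ)) 2) :
    fundamentalEval θ f = f ![u₂ θ, u₁ θ] (weyl θ (-1, -1) 1) -
      halfParam θ ^ (2 : ℤ) * f ![u₁ θ, u₂ θ] (weyl θ (-1, -1) 1) := rfl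

/-- The exponent `(-1, -1)` is the resonance where the coefficients of both `h(u₁)` and `h(u₂)`
vanish; the terms at the products cancel by the relation of `u₁` and `u₂`. -/
theorem fundamentalEval_hochschildD
    (h : HochschildCochain ℂ (TorusOrbifold θ) (DualBimodule ℂ (TorusOrbifold θ)) 1) :
    fundamentalEval θ (hochschildD ℂ _ _ 1 h) = 0 := by
  have h0 := halfParam_ne_zero θ
  have hsmul : h ![u₂ θ * u₁ θ] = halfParam θ ^ (2 : ℤ) • h ![u₁ θ * u₂ θ] := by
    rw [u₂_mul_u₁]
    exact h.cons_smul ![] _ _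
  rw [fundamentalEval_apply, hochschildD_one_apply, hochschildD_one_apply, hsmul]
  simp only [DualBimodule.add_apply, DualBimodule.sub_apply]
  rw [DualBimodule.smul_apply, DualBimodule.smul_apply, DualBimodule.op_smul_apply,
    DualBimodule.op_smul_apply, DualBimodule.smul_scalar_apply, weyl_mul_u₁, weyl_mul_u₂,
    u₁_mul_weyl, u₂_mul_weyl]
  simp only [DualBimodule.map_smul, neg_neg, zpow_one, zpow_neg_one]
  rw [show halfParam θ ^ (2 : ℤ) = halfParam θ * halfParam θ by rw [zpow_ofNat, pow_two]]
  field_simp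
  ring

/-- The area form has opposite signs on the two orderings, so the two terms add instead of
cancelling and give `2 * halfParam θ`. -/
theorem fundamentalEval_fundamentalCocycle :
    fundamentalEval θ (HochschildCochain.ofBilin (fundamentalCocycle θ)) ≠ 0 := by
  have h0 := halfParam_ne_zero θ
  have hg : ∀ p, gradeMap θ (weyl θ p 1) = weyl θ p 1 := fun p => by
    rw [gradeMap, weylDiag_weyl, sign_one, Int.cast_one, one_smul]
  have h21 : areaMap θ (u₂ θ) (u₁ θ) = u₂ θ * u₁ θ := by
    rw [areaMap_apply, u₁, u₂, hg]
    simp [degreeMap, weylDiag_weyl]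
  have h12 : areaMap θ (u₁ θ) (u₂ θ) = -(u₁ θ * u₂ θ) := by
    rw [areaMap_apply, u₁, u₂, hg]
    simp [degreeMap, weylDiag_weyl]
  have e12 : u₁ θ * u₂ θ = halfParam θ ^ (-1 : ℤ) • weyl θ (1, 1) 1 := by
    rw [u₂, u₁_mul_weyl]; rfl
  have e : weyl θ (1, 1) 1 * weyl θ (-1, -1) 1 = 1 := (weylUnit θ (1, 1)).mul_inv
  have hτ : orbifoldTrace θ 1 0 1 = 1 := by
    rw [← weyl_zero_one, orbifoldTrace_weyl_one, if_pos rfl]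
  rw [fundamentalEval_apply, HochschildCochain.ofBilin_apply, HochschildCochain.ofBilin_apply,
    fundamentalCocycle_apply, fundamentalCocycle_apply, h21, h12, u₂_mul_u₁, e12, neg_mul,
    smul_mul_assoc, smul_mul_assoc, e,
    ← neg_one_smul ℂ (halfParam θ ^ (-1 : ℤ) • (1 : TorusOrbifold θ)), DualBimodule.map_smul,
    DualBimodule.map_smul, DualBimodule.map_smul, DualBimodule.map_smul, hτ]
  rw [show halfParam θ ^ (2 : ℤ) * (halfParam θ ^ (-1 : ℤ) * 1) -
    halfParam θ ^ (2 : ℤ) * (-1 * (halfParam θ ^ (-1 : ℤ) * 1)) =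
      2 * (halfParam θ ^ (2 : ℤ) * halfParam θ ^ (-1 : ℤ)) by ring]
  exact mul_ne_zero two_ne_zero (mul_ne_zero (zpow_ne_zero _ h0) (zpow_ne_zero _ h0))

theorem mem_hochschildCocycles_two_iff
    (f : HochschildCochain ℂ (TorusOrbifold θ) (DualBimodule ℂ (TorusOrbifold θ)) 2) :
    f ∈ hochschildCocycles ℂ _ _ 2 ↔ IsHochschildTwoCocycle f.toBilin := by
  rw [LinearMap.mem_ker]
  constructor
  · intro hf a b c
    have h := hochschildD_two_apply f a b c
    rw [hf, zero_apply] at h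
    exact h.symm
  · intro hf
    ext1 x
    have vec : x = ![x 0, x 1, x 2] := by ext1 i; fin_cases i <;> rfl
    rw [vec, hochschildD_two_apply, zero_apply]
    exact hf _ _ _

/-- A 2-cocycle on which the fundamental evaluation vanishes is a coboundary. -/
theorem exists_hochschildD_eq (hθ : Irrational θ)
    {f : HochschildCochain ℂ (TorusOrbifold θ) (DualBimodule ℂ (TorusOrbifold θ)) 2}
    (hf : f ∈ hochschildCocycles ℂ _ _ 2) (h0 : fundamentalEval θ f = 0) :
    ∃ h, hochschildD ℂ (TorusOrbifold θ) (DualBimodule ℂ (TorusOrbifold θ)) 1 h = f := by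
  have hF := (mem_hochschildCocycles_two_iff f).1 hf
  -- The lifts `(u₁, y₁)` and `(u₂, y₂)` satisfy the defining relation in the extension exactly when
  -- `y₁`, `y₂` solve this commutator equation.
  obtain ⟨y₁, y₂, hy⟩ := exists_commutator_correction hθ
    (f.toBilin (u₂ θ) (u₁ θ) - halfParam θ ^ (2 : ℤ) • f.toBilin (u₁ θ) (u₂ θ)) (by
      rw [DualBimodule.sub_apply, DualBimodule.smul_scalar_apply]
      exact h0)
  obtain ⟨σ, hmul, hσ⟩ := exists_section_of_lifts (CocycleExtension.proj hF)
    CocycleExtension.proj_surjective CocycleExtension.mul_eq_zero_of_proj_eq_zero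
    (V₁ := CocycleExtension.mk hF (u₁ θ) y₁) (V₂ := CocycleExtension.mk hF (u₂ θ) y₂)
    rfl rfl (by
      ext1
      · exact u₂_mul_u₁
      · rw [CocycleExtension.snd_smul, CocycleExtension.snd_mul, CocycleExtension.snd_mul,
          ← sub_eq_zero, ← hy]
        simp only [CocycleExtension.fst_mk, CocycleExtension.snd_mk, smul_add]
        abel)
  have hfst : ∀ x, (σ x).fst = x := hσ
  let g : TorusOrbifold θ →ₗ[ℂ] DualBimodule ℂ (TorusOrbifold θ) :=
    CocycleExtension.sndHom hF ∘ₗ σ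
  have hg : ∀ x y, g (x * y) = x • g y + MulOpposite.op y • g x + f ![x, y] := by
    intro x y
    have h := congrArg CocycleExtension.snd (hmul x y)
    rw [CocycleExtension.snd_mul, hfst, hfst] at h
    exact h
  -- Multiplicativity of the section says that `f` is minus the differential of its bimodule
  -- component `g`, hence the sign.
  refine ⟨-MultilinearMap.ofSubsingleton ℂ _ _ (0 : Fin 1) g, ?_⟩
  ext1 x
  have vec : x = ![x 0, x 1] := by ext1 i; fin_cases i <;> rfl
  have hval : ∀ a, MultilinearMap.ofSubsingleton ℂ (TorusOrbifold θ)
      (DualBimodule ℂ (TorusOrbifold θ)) (0 : Fin 1) g ![a] = g a := fun a => rfl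
  rw [vec, map_neg, neg_apply, hochschildD_one_apply, hval, hval, hval, hg]
  abel

theorem nonempty_hochschild_two_equiv (hθ : Irrational θ) : Nonempty
    (HochschildCohomology ℂ (TorusOrbifold θ) (DualBimodule ℂ (TorusOrbifold θ)) 2
      ≃ₗ[ℂ] ℂ) := by
  let ev := (fundamentalEval θ).domRestrict
    (hochschildCocycles ℂ (TorusOrbifold θ) (DualBimodule ℂ (TorusOrbifold θ)) 2)
  have hker : (hochschildCoboundaries ℂ (TorusOrbifold θ)
      (DualBimodule ℂ (TorusOrbifold θ)) 2).submoduleOf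
      (hochschildCocycles ℂ (TorusOrbifold θ) (DualBimodule ℂ (TorusOrbifold θ)) 2) =
        LinearMap.ker ev := by
    ext ⟨f, hf⟩
    constructor
    · rintro ⟨h, rfl⟩
      exact fundamentalEval_hochschildD h
    · intro h
      exact exists_hochschildD_eq hθ hf h
  have hsurj : Function.Surjective ev := by
    have hmem : HochschildCochain.ofBilin (fundamentalCocycle θ) ∈ hochschildCocycles ℂ
        (TorusOrbifold θ) (DualBimodule ℂ (TorusOrbifold θ)) 2 :=
      (mem_hochschildCocycles_two_iff _).2 isHochschildTwoCocycle_fundamentalCocycle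
    refine LinearMap.surjective fun h => fundamentalEval_fundamentalCocycle (θ := θ) ?_
    exact LinearMap.congr_fun h ⟨_, hmem⟩
  exact ⟨(Submodule.quotEquivOfEq _ _ hker).trans (ev.quotKerEquivOfSurjective hsurj)⟩

end AlgNCTorus

theorem theorem1p1 (θ : ℝ) (hθ : Irrational θ) :
    Nonempty (HochschildCohomology ℂ (TorusOrbifold θ) (DualBimodule ℂ (TorusOrbifold θ)) 0
      ≃ₗ[ℂ] (Fin 5 → ℂ)) ∧
    Subsingleton
      (HochschildCohomology ℂ (TorusOrbifold θ) (DualBimodule ℂ (TorusOrbifold θ)) 1) ∧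
    Nonempty (HochschildCohomology ℂ (TorusOrbifold θ) (DualBimodule ℂ (TorusOrbifold θ)) 2
      ≃ₗ[ℂ] ℂ) := by
  exact ⟨AlgNCTorus.nonempty_hochschild_zero_equiv hθ, AlgNCTorus.subsingleton_hochschild_one hθ,
    AlgNCTorus.nonempty_hochschild_two_equiv hθ⟩
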